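/- Let $n\ge 1$ and $d\ge 0$ be integers and let $M$ be a connected matroid of rank $d+1$ on the ground set $\{0,1,\dots,n\}$ that is sparse paving, i.e. every subset of $\{0,\dots,n\}$ of size $d+1$ is either a basis of $M$ or a circuit-hyperplane of $M$ (a hyperplane that is also a circuit). Let $\alpha$ be the number of circuit-hyperplanes of $M$, and let $P_M=\mathrm{conv}\{\sum_{i\in B}e_i : B \text{ a basis of } M\}\subseteq\mathbb{R}^{n+1}$ be its base polytope. Then $$\mathrm{Vol}(P_M)=\frac{1}{n!}\left(A_{n,d}-\alpha\binom{n-1}{d}\right),$$ where $A_{n,d}$ is the Eulerian number, i.e. the number of permutations of $\{1,\dots,n\}$ with exactly $d$ descents, and $\mathrm{Vol}$ denotes the normalised volume in the affine hull of $P_M$, in which a fundamental parallelepiped of the lattice of integer vectors parallel to the affine hull has volume $1$. -/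

import Mathlib

open scoped MeasureTheory

namespace Matroid

/-- The incidence vector `∑ i ∈ S, e_i` of a set `S` of coordinates. -/
noncomputable def incidenceVector {ι : Type*} (S : Set ι) : EuclideanSpace ℝ ι :=
  WithLp.toLp 2 (S.indicator (fun _ => (1 : ℝ)))

/-- The base polytope of a matroid: the convex hull of the incidence vectors of its bases. -/
noncomputable def basePolytope {ι : Type*} (M : Matroid ι) : Set (EuclideanSpace ℝ ι) :=
  convexHull ℝ (incidenceVector '' {B : Set ι | M.IsBase B})

/-- A matroid is connected if any two distinct elements of its ground set lie in a common
circuit. -/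
def IsConnected {ι : Type*} (M : Matroid ι) : Prop :=
  ∀ e ∈ M.E, ∀ f ∈ M.E, e ≠ f → ∃ C : Set ι, M.IsCircuit C ∧ e ∈ C ∧ f ∈ C

/-- A hyperplane of a matroid (of finite rank) is a flat whose rank is one less than the rank of
the matroid. -/
def IsHyperplane {ι : Type*} (M : Matroid ι) (H : Set ι) : Prop :=
  M.IsFlat H ∧ M.eRk H + 1 = M.eRank

/-- A circuit-hyperplane is a set that is both a circuit and a hyperplane. -/
def IsCircuitHyperplane {ι : Type*} (M : Matroid ι) (H : Set ι) : Prop :=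
  M.IsCircuit H ∧ M.IsHyperplane H

/-- A matroid of rank `r` is sparse paving if every `r`-element subset of its ground set is a
basis or a circuit-hyperplane. -/
def IsSparsePaving {ι : Type*} (M : Matroid ι) : Prop :=
  ∀ X : Set ι, X ⊆ M.E → X.encard = M.eRank → M.IsBase X ∨ M.IsCircuitHyperplane X

end Matroid

/-- The lattice of integer points in a linear subspace `V` of `ℝ^ι`. -/
def integerPoints {ι : Type*} (V : Submodule ℝ (EuclideanSpace ℝ ι)) : Submodule ℤ V where
  carrier := {v | ∀ i, ∃ k : ℤ, (v : EuclideanSpace ℝ ι) i = k}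
  zero_mem' := fun _ => ⟨0, by simp⟩
  add_mem' := by
    intro a b ha hb i
    obtain ⟨k, hk⟩ := ha i
    obtain ⟨l, hl⟩ := hb i
    exact ⟨k + l, by simp [hk, hl]⟩
  smul_mem' := by
    intro c a ha i
    obtain ⟨k, hk⟩ := ha i
    exact ⟨c * k, by simp [hk]⟩

/-- The normalised volume of a lattice polytope `P ⊆ ℝ^ι` in its affine hull: the `m`-dimensional
Euclidean volume of `P`, where `m` is the dimension of the affine hull, in the unit in which a
fundamental cell of the lattice of integer points parallel to the affine hull has volume `1`. -/
noncomputable def normalisedVolume {ι : Type*} [Fintype ι] (P : Set (EuclideanSpace ℝ ι)) : ℝ :=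
  (μHE[Module.finrank ℝ (vectorSpan ℝ P)] P).toReal /
    ZLattice.covolume (integerPoints (vectorSpan ℝ P)) μHE[Module.finrank ℝ (vectorSpan ℝ P)]

/-- The number of descents of a permutation: positions `i` such that `σ (i + 1) < σ i`. -/
def descentCount {n : ℕ} (σ : Equiv.Perm (Fin n)) : ℕ :=
  (Finset.univ.filter
    (fun i : Fin n => ∃ h : (i : ℕ) + 1 < n, σ ⟨(i : ℕ) + 1, h⟩ < σ i)).card

/-- The Eulerian number `A_{n,d}`: the number of permutations of an `n`-element linearly ordered
set with exactly `d` descents. -/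
def eulerianNumber (n d : ℕ) : ℕ :=
  (Finset.univ.filter (fun σ : Equiv.Perm (Fin n) => descentCount σ = d)).card

/-! Write `r = d + 1`. Connectedness makes `P_M` span the direction space of the hyperplane `∑ x =
r`, and forgetting coordinate `0` maps the integer points of that space onto `ℤⁿ`. The normalised
volume is therefore the Lebesgue measure of a projection (`normalisedVolume_eq`).

The hypersimplex, which is the hull of all `r`-sets, projects up to a null set onto the slice `d ≤ ∑
y < d + 1` of the unit `n`-cube. Partial sums modulo `1` turn the integer part of `∑ y` into a
number of descents, so the slice has volume `A_{n,d} / n!` (`volume_unitCube_slice`).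

Two distinct circuit-hyperplanes share at most `r - 2` elements, since otherwise both would be the
closure of their intersection. Hence removing the vertices `e_H` from the hull amounts exactly to
imposing `∑_{i ∈ H} x i ≤ d` for each circuit-hyperplane `H` (`mem_convexHull_of_sum_le`), and the
open caps cut off in this way are pairwise disjoint (`not_lt_sum_of_lt_sum`). Each cap is a
reflected pyramid of volume `binom(n-1, d) / n!` (`volume_pyramid`), and subtracting `α` of them
gives the formula. -/

open MeasureTheory

/-! ### Normalised volume as Lebesgue measure of a projection -/

/-- The hyperplane of vectors with coordinate sum zero. -/
def sumZeroSubmodule (ι : Type*) [Fintype ι] : Submodule ℝ (EuclideanSpace ℝ ι) where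
  carrier := {v | ∑ i, v i = 0}
  zero_mem' := by simp
  add_mem' := by
    intro a b ha hb
    simp only [Set.mem_ofPred_eq] at *
    simp [Finset.sum_add_distrib, ha, hb]
  smul_mem' := by
    intro c a ha
    simp only [Set.mem_ofPred_eq] at *
    simp [← Finset.mul_sum, ha]

theorem mem_sumZeroSubmodule {ι : Type*} [Fintype ι] {v : EuclideanSpace ℝ ι} :
    v ∈ sumZeroSubmodule ι ↔ ∑ i, v i = 0 := Iff.rfl

/-- Forgetting the first coordinate identifies the sum-zero hyperplane with `ℝⁿ`. -/
noncomputable def sumZeroEquiv (n : ℕ) :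
    sumZeroSubmodule (Fin (n + 1)) ≃ₗ[ℝ] (Fin n → ℝ) where
  toFun v i := (v : EuclideanSpace ℝ (Fin (n + 1))) i.succ
  map_add' _ _ := by ext; simp
  map_smul' _ _ := by ext; simp
  invFun y := ⟨WithLp.toLp 2 (Fin.cons (-∑ i, y i) y : Fin (n + 1) → ℝ), by
    simp [mem_sumZeroSubmodule, Fin.sum_univ_succ]⟩
  left_inv v := by
    have hv := mem_sumZeroSubmodule.1 v.2
    rw [Fin.sum_univ_succ] at hv
    ext i
    refine Fin.cases ?_ (fun j => ?_) i
    · simp; linarith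
    · simp
  right_inv y := by ext i; simp

/-- The point of the hyperplane `∑ x = r` whose coordinates other than the first are given. -/
noncomputable def hyperplaneLift {n : ℕ} (r : ℝ) (y : Fin n → ℝ) : Fin (n + 1) → ℝ :=
  Fin.cons (r - ∑ i, y i) y

/-- The forgotten coordinate is minus the sum of the others, so it is an integer as soon as they
are. -/
theorem integerPoints_sumZero (n : ℕ) :
    integerPoints (sumZeroSubmodule (Fin (n + 1))) =
      ZLattice.comap ℝ (Submodule.span ℤ (Set.range (Pi.basisFun ℝ (Fin n))))
        (sumZeroEquiv n).toContinuousLinearEquiv.toLinearMap := by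
  ext v
  change (∀ i, ∃ k : ℤ, (v : EuclideanSpace ℝ (Fin (n + 1))) i = k) ↔
    sumZeroEquiv n v ∈ (Submodule.span ℤ (Set.range (Pi.basisFun ℝ (Fin n))))
  rw [Module.Basis.mem_span_iff_repr_mem]
  constructor
  · intro h i
    obtain ⟨k, hk⟩ := h i.succ
    exact ⟨k, by simp [sumZeroEquiv, hk]⟩
  · intro h
    have h' : ∀ i : Fin n, ∃ k : ℤ, (v : EuclideanSpace ℝ (Fin (n + 1))) i.succ = k := by
      intro i
      obtain ⟨k, hk⟩ := h i
      exact ⟨k, by simpa [sumZeroEquiv] using hk.symm⟩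
    choose k hk using h'
    intro i
    refine Fin.cases ⟨-∑ j, k j, ?_⟩ (fun j => ⟨k j, hk j⟩) i
    have hv := mem_sumZeroSubmodule.1 v.2
    rw [Fin.sum_univ_succ] at hv
    push_cast
    simp_rw [← hk]
    linarith

/-- The unit cell of `ℤⁿ` has Lebesgue measure one, so the covolume records only the scale of `ν`.
This allows the scale of Hausdorff measure to cancel later without being computed. -/
theorem covolume_span_basisFun {n : ℕ} (ν : Measure (Fin n → ℝ)) [ν.IsAddHaarMeasure] :
    ZLattice.covolume (Submodule.span ℤ (Set.range (Pi.basisFun ℝ (Fin n)))) ν =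
      (ν.addHaarScalarFactor volume : ℝ) := by
  have h := congrArg (fun m : Measure (Fin n → ℝ) =>
    m (ZSpan.fundamentalDomain (Pi.basisFun ℝ (Fin n))))
    (Measure.isAddLeftInvariant_eq_smul ν volume)
  rw [ZLattice.covolume_eq_measure_fundamentalDomain _ _
    (ZSpan.isAddFundamentalDomain (Pi.basisFun ℝ (Fin n)) _), measureReal_def, h]
  have h1 : (volume (ZSpan.fundamentalDomain (Pi.basisFun ℝ (Fin n)))) = 1 := by
    rw [ZSpan.fundamentalDomain_pi_basisFun, volume_pi, Measure.pi_pi]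
    simp
  rw [Measure.smul_apply, h1, ENNReal.smul_def, smul_eq_mul, mul_one, ENNReal.coe_toReal]

theorem toLp_hyperplaneLift {n : ℕ} (r : ℝ) (y : Fin n → ℝ) :
    WithLp.toLp 2 (hyperplaneLift r y) = WithLp.toLp 2 (hyperplaneLift r (0 : Fin n → ℝ)) +
      ((sumZeroEquiv n).symm y : EuclideanSpace ℝ (Fin (n + 1))) := by
  ext i
  refine Fin.cases ?_ (fun j => ?_) i
  · simp [hyperplaneLift, sumZeroEquiv]; ring
  · simp [hyperplaneLift, sumZeroEquiv]

/-- `P` is an isometric copy of a subset of `V`, and the linear chart `e` pushes Hausdorff measure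
on `V` to a multiple of Lebesgue measure. The same Haar factor appears in the numerator and in the
covolume. Keeping `V` a variable with an equation allows `subst` despite the dependent types. -/
theorem volume_div_covolume_eq {n : ℕ} (r : ℝ) (P : Set (EuclideanSpace ℝ (Fin (n + 1))))
    (hP : ∀ x ∈ P, ∑ i, x i = r) (V : Submodule ℝ (EuclideanSpace ℝ (Fin (n + 1))))
    (hV : V = sumZeroSubmodule (Fin (n + 1))) :
    (μHE[Module.finrank ℝ V] P).toReal / ZLattice.covolume (integerPoints V)
        μHE[Module.finrank ℝ V] =
      (volume {y : Fin n → ℝ | WithLp.toLp 2 (hyperplaneLift r y) ∈ P}).toReal := by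
  subst hV
  set V := sumZeroSubmodule (Fin (n + 1))
  set e := (sumZeroEquiv n).toContinuousLinearEquiv
  set S := {y : Fin n → ℝ | WithLp.toLp 2 (hyperplaneLift r y) ∈ P}
  set μ : Measure V := μHE[Module.finrank ℝ V] with hμ
  have hmap : (μ.map e).IsAddHaarMeasure := e.isAddHaarMeasure_map μ
  have hcov : ZLattice.covolume (integerPoints V) μ =
      ((μ.map e).addHaarScalarFactor volume : ℝ) := by
    rw [← covolume_span_basisFun, integerPoints_sumZero]
    exact ZLattice.covolume_comap _ (μ.map e) μ (e := e)
      ⟨e.continuous.measurable, rfl⟩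
  have himage : P = (fun v : V => WithLp.toLp 2 (hyperplaneLift r (0 : Fin n → ℝ)) +
      (v : EuclideanSpace ℝ (Fin (n + 1)))) '' (e ⁻¹' S) := by
    ext x
    constructor
    · intro hx
      have hx' : WithLp.toLp 2 (hyperplaneLift r (fun i : Fin n => x i.succ)) = x := by
        have := hP x hx
        rw [Fin.sum_univ_succ] at this
        ext i
        refine Fin.cases ?_ (fun j => ?_) i
        · simp [hyperplaneLift]; linarith
        · simp [hyperplaneLift]
      refine ⟨(sumZeroEquiv n).symm (fun i : Fin n => x i.succ), ?_, ?_⟩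
      · change WithLp.toLp 2 (hyperplaneLift r (sumZeroEquiv n _)) ∈ P
        rw [LinearEquiv.apply_symm_apply, hx']
        exact hx
      · change _ + _ = _
        rw [← toLp_hyperplaneLift, hx']
    · rintro ⟨v, hv, rfl⟩
      change WithLp.toLp 2 (hyperplaneLift r (sumZeroEquiv n v)) ∈ P at hv
      rw [toLp_hyperplaneLift, LinearEquiv.symm_apply_apply] at hv
      exact hv
  have hiso : Isometry (fun v : V => WithLp.toLp 2 (hyperplaneLift r (0 : Fin n → ℝ)) +
      (v : EuclideanSpace ℝ (Fin (n + 1)))) :=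
    (IsometryEquiv.addLeft _).isometry.comp isometry_subtype_coe
  have hvol : (μHE[Module.finrank ℝ V] P : ENNReal) =
      ((μ.map e).addHaarScalarFactor volume : ENNReal) * volume S := by
    rw [himage, hiso.euclideanHausdorffMeasure_image]
    have h1 : μ (e ⁻¹' S) = μ.map e S :=
      (e.toHomeomorph.toMeasurableEquiv.map_apply (μ := μ) S).symm
    rw [← hμ, h1]
    conv_lhs => rw [Measure.isAddLeftInvariant_eq_smul (μ.map e) volume]
    rfl
  rw [hcov, hvol, ENNReal.toReal_mul]
  have hne : ((μ.map e).addHaarScalarFactor volume : ℝ) ≠ 0 := by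
    have := Measure.addHaarScalarFactor_pos_of_isAddHaarMeasure (μ.map e) volume
    exact_mod_cast this.ne'
  rw [ENNReal.coe_toReal, mul_div_cancel_left₀ _ hne]

/-- The normalised volume of a subset of the hyperplane `∑ x = r` that spans it is the Lebesgue
measure of its projection that forgets the first coordinate. -/
theorem normalisedVolume_eq {n : ℕ} (r : ℝ) (P : Set (EuclideanSpace ℝ (Fin (n + 1))))
    (hP : ∀ x ∈ P, ∑ i, x i = r) (hspan : vectorSpan ℝ P = sumZeroSubmodule (Fin (n + 1))) :
    normalisedVolume P =
      (volume {y : Fin n → ℝ | WithLp.toLp 2 (hyperplaneLift r y) ∈ P}).toReal :=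
  volume_div_covolume_eq r P hP _ hspan

/-! ### The hypersimplex and the hull of part of its vertices -/

/-- The hypersimplex: the points of the unit cube with coordinate sum `r`. -/
def hypersimplex (ι : Type*) [Fintype ι] (r : ℕ) : Set (ι → ℝ) :=
  {x | (∀ i, x i ∈ Set.Icc (0 : ℝ) 1) ∧ ∑ i, x i = r}

/-- The indicator vector of a finite set. -/
noncomputable def indicatorVector {ι : Type*} [DecidableEq ι] (X : Finset ι) : ι → ℝ :=
  fun i => if i ∈ X then 1 else 0

theorem sum_indicatorVector {ι : Type*} [DecidableEq ι] (X Y : Finset ι) :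
    ∑ i ∈ Y, indicatorVector X i = ((X ∩ Y).card : ℝ) := by
  simp [indicatorVector, Finset.sum_ite_mem, Finset.inter_comm]

theorem convex_hypersimplex {ι : Type*} [Fintype ι] (r : ℕ) : Convex ℝ (hypersimplex ι r) := by
  intro x hx y hy a b ha hb hab
  refine ⟨fun i => (convex_Icc (0 : ℝ) 1) (hx.1 i) (hy.1 i) ha hb hab, ?_⟩
  simp only [Pi.add_apply, Pi.smul_apply, smul_eq_mul, Finset.sum_add_distrib, ← Finset.mul_sum,
    hx.2, hy.2, ← add_mul, hab, one_mul]

theorem isCompact_hypersimplex {ι : Type*} [Fintype ι] (r : ℕ) : IsCompact (hypersimplex ι r) := by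
  have h : hypersimplex ι r = (Set.pi Set.univ fun _ : ι => Set.Icc (0 : ℝ) 1) ∩
      {x | ∑ i, x i = r} := by
    ext x
    simp only [hypersimplex, Set.mem_inter_iff, Set.mem_pi, Set.mem_univ, true_imp_iff,
      Set.mem_ofPred_eq]
  rw [h]
  exact (isCompact_univ_pi fun _ => isCompact_Icc).inter_right
    (isClosed_eq (by fun_prop) continuous_const)

section

variable {ι : Type*} [Fintype ι] [DecidableEq ι]

theorem indicatorVector_mem_hypersimplex {X : Finset ι} {r : ℕ} (hX : X.card = r) :
    indicatorVector X ∈ hypersimplex ι r := by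
  refine ⟨fun i => ?_, ?_⟩
  · unfold indicatorVector; split_ifs <;> simp
  · rw [sum_indicatorVector, Finset.inter_univ, hX]

/-- Two fractional coordinates allow a perturbation within the hypersimplex. -/
theorem not_mem_extremePoints_of_fractional {r : ℕ} {x : ι → ℝ} {i j : ι} (hij : i ≠ j)
    (hi : x i ∈ Set.Ioo (0 : ℝ) 1) (hj : x j ∈ Set.Ioo (0 : ℝ) 1) :
    x ∉ Set.extremePoints ℝ (hypersimplex ι r) := by
  intro hx
  rw [mem_extremePoints] at hx
  obtain ⟨hxΔ, hext⟩ := hx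
  obtain ⟨ε, hε, h1, h2, h3, h4⟩ : ∃ ε : ℝ, 0 < ε ∧ ε ≤ x i ∧ ε ≤ 1 - x i ∧ ε ≤ x j ∧
      ε ≤ 1 - x j :=
    ⟨min (min (x i) (1 - x i)) (min (x j) (1 - x j)), by
      simp [hi.1, hi.2, hj.1, hj.2], by simp, by simp, by simp, by simp⟩
  have key : ∀ δ : ℝ, |δ| ≤ ε → x + (Pi.single i δ - Pi.single j δ) ∈ hypersimplex ι r := by
    intro δ hδ
    rw [abs_le] at hδ
    refine ⟨fun k => ?_, ?_⟩
    · by_cases hki : k = i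
      · subst hki
        simp [hij]
        constructor <;> linarith [hδ.1, hδ.2]
      · by_cases hkj : k = j
        · subst hkj
          simp [hki]
          constructor <;> linarith [hδ.1, hδ.2]
        · simpa [hki, hkj] using hxΔ.1 k
    · simp [Finset.sum_add_distrib, hxΔ.2]
  have := (hext _ (key ε (abs_of_pos hε).le) _ (key (-ε) (by rw [abs_neg, abs_of_pos hε]))
    ⟨1 / 2, 1 / 2, by norm_num, by norm_num, by norm_num, by
      rw [Pi.single_neg, Pi.single_neg]
      module⟩).1
  have := congrFun this i
  simp [hij] at this
  exact hε.ne' this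

theorem extremePoints_hypersimplex_subset (r : ℕ) :
    Set.extremePoints ℝ (hypersimplex ι r) ⊆
      indicatorVector '' {X : Finset ι | X.card = r} := by
  intro x hx
  have hxΔ := (mem_extremePoints.1 hx).1
  have hfrac : ∀ i, x i = 0 ∨ x i = 1 := by
    by_contra! hne
    obtain ⟨i, hi0, hi1⟩ := hne
    have hi : x i ∈ Set.Ioo (0 : ℝ) 1 :=
      ⟨lt_of_le_of_ne (hxΔ.1 i).1 (Ne.symm hi0), lt_of_le_of_ne (hxΔ.1 i).2 hi1⟩
    have hother : ∀ j, j ≠ i → x j = 0 ∨ x j = 1 := by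
      intro j hji
      by_contra! hne
      exact not_mem_extremePoints_of_fractional hji.symm hi
        ⟨lt_of_le_of_ne (hxΔ.1 j).1 (Ne.symm hne.1), lt_of_le_of_ne (hxΔ.1 j).2 hne.2⟩ hx
    -- A single fractional coordinate is impossible, because the coordinate sum and all other
    -- coordinates are integers.
    have hintegral : ∃ m : ℤ, ∑ j ∈ Finset.univ.erase i, x j = m := by
      refine Finset.sum_induction _ (fun t : ℝ => ∃ m : ℤ, t = (m : ℝ)) ?_ ⟨0, by simp⟩ ?_
      · rintro _ _ ⟨a, rfl⟩ ⟨b, rfl⟩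
        exact ⟨a + b, by push_cast; ring⟩
      · intro j hj
        rcases hother j (Finset.ne_of_mem_erase hj) with h | h
        · exact ⟨0, by simp [h]⟩
        · exact ⟨1, by simp [h]⟩
    obtain ⟨m, hm⟩ := hintegral
    have hs := hxΔ.2
    rw [← Finset.add_sum_erase _ _ (Finset.mem_univ i), hm] at hs
    have hxi : x i = ((r - m : ℤ) : ℝ) := by push_cast; linarith
    rw [hxi] at hi
    have h1 : (0 : ℤ) < r - m := by exact_mod_cast hi.1
    have h2 : (r - m : ℤ) < 1 := by exact_mod_cast hi.2
    omega
  have hxX : x = indicatorVector (Finset.univ.filter fun i => x i = 1) := by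
    ext i
    rcases hfrac i with h | h <;> simp [indicatorVector, h]
  refine ⟨Finset.univ.filter fun i => x i = 1, ?_, hxX.symm⟩
  have hs := hxΔ.2
  rw [hxX, sum_indicatorVector, Finset.inter_univ] at hs
  exact_mod_cast hs

/-- Krein–Milman; the closure is harmless because the hull of finitely many points is compact. -/
theorem hypersimplex_eq_convexHull (r : ℕ) :
    hypersimplex ι r = convexHull ℝ (indicatorVector '' {X : Finset ι | X.card = r}) := by
  apply Set.Subset.antisymm
  · rw [← closure_convexHull_extremePoints (isCompact_hypersimplex r) (convex_hypersimplex r)]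
    refine closure_minimal (convexHull_mono (extremePoints_hypersimplex_subset r)) ?_
    exact ((Set.toFinite _).isCompact_convexHull (𝕜 := ℝ)).isClosed
  · refine convexHull_min ?_ (convex_hypersimplex r)
    rintro _ ⟨X, hX, rfl⟩
    exact indicatorVector_mem_hypersimplex hX

/-- The coefficient families that write `x` as a convex combination of the vertices of the
hypersimplex. -/
def vertexWeights (r : ℕ) (x : ι → ℝ) : Set (Finset ι → ℝ) :=
  {w | (∀ X, 0 ≤ w X) ∧ ∑ X, w X = 1 ∧ (∀ X, X.card ≠ r → w X = 0) ∧
    ∀ i, ∑ X, w X * indicatorVector X i = x i}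

theorem isCompact_vertexWeights (r : ℕ) (x : ι → ℝ) : IsCompact (vertexWeights r x) := by
  refine (isCompact_stdSimplex ℝ (Finset ι)).of_isClosed_subset ?_ fun w hw => ⟨hw.1, hw.2.1⟩
  have : vertexWeights r x = (⋂ X, {w | 0 ≤ w X}) ∩ ({w | ∑ X, w X = 1} ∩
      ((⋂ X, ⋂ (_ : X.card ≠ r), {w | w X = 0}) ∩
        ⋂ i, {w | ∑ X, w X * indicatorVector X i = x i})) := by
    ext w; simp [vertexWeights]
  rw [this]
  refine (isClosed_iInter fun X => isClosed_le continuous_const (by fun_prop)).inter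
    ((isClosed_eq (by fun_prop) continuous_const).inter
    ((isClosed_iInter fun X => isClosed_iInter fun _ =>
      isClosed_eq (by fun_prop) continuous_const).inter
    (isClosed_iInter fun i => isClosed_eq (by fun_prop) continuous_const)))

theorem vertexWeights_nonempty {r : ℕ} {x : ι → ℝ} (hx : x ∈ hypersimplex ι r) :
    (vertexWeights r x).Nonempty := by
  rw [hypersimplex_eq_convexHull] at hx
  refine convexHull_min (t := {x | (vertexWeights r x).Nonempty}) ?_ ?_ hx
  · rintro _ ⟨X, hX, rfl⟩
    refine ⟨Pi.single X 1, fun Y => ?_, by simp, fun Y hY => ?_, fun i => ?_⟩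
    · rw [Pi.single_apply]; split_ifs <;> simp
    · rw [Pi.single_apply, if_neg]
      rintro rfl
      exact hY hX
    · simp [Pi.single_apply, ite_mul]
  · rintro y ⟨v, hv0, hv1, hv2, hv3⟩ z ⟨w, hw0, hw1, hw2, hw3⟩ a b ha hb hab
    refine ⟨a • v + b • w, fun Y => ?_, ?_, fun Y hY => ?_, fun i => ?_⟩
    · have := mul_nonneg ha (hv0 Y)
      have := mul_nonneg hb (hw0 Y)
      simp only [Pi.add_apply, Pi.smul_apply, smul_eq_mul]
      linarith
    · simp [Finset.sum_add_distrib, ← Finset.mul_sum, hv1, hw1, hab]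
    · simp [hv2 Y hY, hw2 Y hY]
    · simp [add_mul, mul_assoc, Finset.sum_add_distrib, ← Finset.mul_sum, hv3, hw3]

/-- Exchange step: moving weight from `H, X` to `H', X'` when `e_H + e_X = e_{H'} + e_{X'}`. -/
theorem vertexWeights_exchange {r : ℕ} {x : ι → ℝ} {w : Finset ι → ℝ} (hw : w ∈ vertexWeights r x)
    {H X H' X' : Finset ι} (hHX : H ≠ X) {ε : ℝ} (hε : 0 ≤ ε) (hH : ε ≤ w H) (hX : ε ≤ w X)
    (hH' : H'.card = r) (hX' : X'.card = r) (hHr : H.card = r) (hXr : X.card = r)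
    (hsum : indicatorVector H + indicatorVector X = indicatorVector H' + indicatorVector X') :
    w - Pi.single H ε - Pi.single X ε + Pi.single H' ε + Pi.single X' ε ∈ vertexWeights r x := by
  obtain ⟨h0, h1, h2, h3⟩ := hw
  refine ⟨fun Y => ?_, ?_, fun Y hY => ?_, fun i => ?_⟩
  · have hp : ∀ Z : Finset ι, 0 ≤ (Pi.single Z ε : Finset ι → ℝ) Y := fun Z => by
      rw [Pi.single_apply]; split_ifs <;> simp [hε]
    have := hp H'
    have := hp X'
    have : 0 ≤ w Y - (Pi.single H ε : Finset ι → ℝ) Y - (Pi.single X ε : Finset ι → ℝ) Y := by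
      by_cases hYH : Y = H
      · subst hYH; simp [hHX, hH]
      · by_cases hYX : Y = X
        · subst hYX; simp [hYH, hX]
        · simp [hYH, hYX, h0]
    simp only [Pi.add_apply, Pi.sub_apply]
    linarith
  · simp [Finset.sum_add_distrib, h1]
  · have hne : ∀ Z : Finset ι, Z.card = r → Y ≠ Z := fun Z hZ h => hY (h ▸ hZ)
    simp [h2 Y hY, hne H hHr, hne X hXr, hne H' hH', hne X' hX']
  · have := congrFun hsum i
    simp only [Pi.add_apply] at this
    simp [add_mul, sub_mul, Finset.sum_add_distrib, h3, Pi.single_apply, ite_mul]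
    linear_combination ε * (-this)

/-- A point of the hypersimplex that satisfies `∑_{i ∈ H} x i ≤ r - 1` for all members `H` of a
family of `r`-sets with pairwise intersections of size at most `r - 2` is a convex combination of
the vertices outside the family. -/
theorem mem_convexHull_of_sum_le {r : ℕ} (𝒞 : Finset (Finset ι)) (hcard : ∀ H ∈ 𝒞, H.card = r)
    (hinter : ∀ H ∈ 𝒞, ∀ H' ∈ 𝒞, H ≠ H' → (H ∩ H').card + 2 ≤ r) {x : ι → ℝ}
    (hx : x ∈ hypersimplex ι r) (hle : ∀ H ∈ 𝒞, ∑ i ∈ H, x i ≤ (r : ℝ) - 1) :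
    x ∈ convexHull ℝ (indicatorVector '' {X : Finset ι | X.card = r ∧ X ∉ 𝒞}) := by
  -- Among all ways of writing `x` as a combination of vertices, take one with least total weight on
  -- `𝒞`; an exchange argument shows that this weight is zero.
  obtain ⟨w, hw, hmin⟩ := (isCompact_vertexWeights r x).exists_isMinOn (vertexWeights_nonempty hx)
    (f := fun w : Finset ι → ℝ => ∑ H ∈ 𝒞, w H) (by fun_prop)
  have hzero : ∀ H ∈ 𝒞, w H = 0 := by
    intro H hH
    by_contra hne
    have hpos : 0 < w H := lt_of_le_of_ne (hw.1 H) (Ne.symm hne)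
    -- `∑_{i ∈ H} x i` is the `w`-average of `|X ∩ H|`. If every `X` of positive weight had `|X ∩ H|
    -- ≥ r - 1`, then `H` itself, contributing `r`, would push the average above `r - 1`.
    obtain ⟨X, hXpos, hXinter⟩ : ∃ X, 0 < w X ∧ (X ∩ H).card + 2 ≤ r := by
      by_contra! hno
      have h1 : ∑ i ∈ H, x i = ∑ X, w X * ((X ∩ H).card : ℝ) := by
        simp_rw [← hw.2.2.2, ← sum_indicatorVector, Finset.mul_sum]
        exact Finset.sum_comm
      have h2 : ∑ X, w X * ((r : ℝ) - 1) < ∑ X, w X * ((X ∩ H).card : ℝ) := by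
        refine Finset.sum_lt_sum (fun X _ => ?_) ⟨H, Finset.mem_univ _, ?_⟩
        · rcases (hw.1 X).eq_or_lt with h | h
          · simp [← h]
          · have := hno X h
            have h3 : (r : ℝ) < (X ∩ H).card + 2 := by exact_mod_cast this
            have h4 : r ≤ (X ∩ H).card + 1 := by omega
            have h5 : (r : ℝ) ≤ (X ∩ H).card + 1 := by exact_mod_cast h4
            exact mul_le_mul_of_nonneg_left (by linarith) h.le
        · rw [Finset.inter_self, hcard H hH]
          exact mul_lt_mul_of_pos_left (by linarith) hpos
      rw [← Finset.sum_mul, hw.2.1, one_mul, ← h1] at h2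
      exact absurd (hle H hH) (not_le.2 h2)
    have hXr : X.card = r := by
      by_contra h
      exact hXpos.ne' (hw.2.2.1 X h)
    have hHr := hcard H hH
    have hHX : H ≠ X := by
      rintro rfl
      rw [Finset.inter_self] at hXinter
      omega
    have hcard1 : 1 < (H \ X).card := by
      have := Finset.card_sdiff_add_card_inter H X
      rw [Finset.inter_comm] at this
      omega
    have hcard2 : 0 < (X \ H).card := by
      have := Finset.card_sdiff_add_card_inter X H
      omega
    obtain ⟨b, hb⟩ := Finset.card_pos.1 hcard2
    obtain ⟨a₁, ha₁, a₂, ha₂, ha⟩ := Finset.one_lt_card.1 hcard1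
    rw [Finset.mem_sdiff] at hb ha₁ ha₂
    -- There are at least two candidates for `a` in `H \ X`. The resulting sets share the `r - 1`
    -- elements of `X.erase b`, so they cannot both lie in `𝒞`.
    obtain ⟨a, haH, haX, haC⟩ : ∃ a, a ∈ H ∧ a ∉ X ∧ insert a (X.erase b) ∉ 𝒞 := by
      by_contra! hno
      have m₁ := hno a₁ ha₁.1 ha₁.2
      have m₂ := hno a₂ ha₂.1 ha₂.2
      have hne : insert a₁ (X.erase b) ≠ insert a₂ (X.erase b) := by
        intro h
        have : a₁ ∈ insert a₂ (X.erase b) := h ▸ Finset.mem_insert_self _ _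
        simp [ha, ha₁.2] at this
      have := hinter _ m₁ _ m₂ hne
      have hsub : X.erase b ⊆ insert a₁ (X.erase b) ∩ insert a₂ (X.erase b) :=
        Finset.subset_inter (Finset.subset_insert _ _) (Finset.subset_insert _ _)
      have := Finset.card_le_card hsub
      rw [Finset.card_erase_of_mem hb.1] at this
      omega
    have hab : a ≠ b := fun h => haX (h ▸ hb.1)
    have hr : 0 < r := by omega
    have hcH : (insert b (H.erase a)).card = r := by
      rw [Finset.card_insert_of_notMem (by simp [hb.2]), Finset.card_erase_of_mem haH, hHr]
      omega
    have hcX : (insert a (X.erase b)).card = r := by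
      rw [Finset.card_insert_of_notMem (by simp [haX]), Finset.card_erase_of_mem hb.1, hXr]
      omega
    have hHC : insert b (H.erase a) ∉ 𝒞 := by
      intro hmem
      have hne : H ≠ insert b (H.erase a) := by
        intro h
        exact hb.2 (h ▸ Finset.mem_insert_self _ _)
      have h1 := hinter _ hH _ hmem hne
      have hsub : H.erase a ⊆ H ∩ insert b (H.erase a) :=
        Finset.subset_inter (Finset.erase_subset _ _) (Finset.subset_insert _ _)
      have := Finset.card_le_card hsub
      rw [Finset.card_erase_of_mem haH] at this
      omega
    have hsum : indicatorVector H + indicatorVector X =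
        indicatorVector (insert b (H.erase a)) + indicatorVector (insert a (X.erase b)) := by
      ext i
      by_cases hia : i = a
      · subst hia; simp [indicatorVector, haH, haX, hab]
      · by_cases hib : i = b
        · subst hib; simp [indicatorVector, hb.1, hb.2, hia]
        · simp [indicatorVector, hia, hib]
    have hεpos : 0 < min (w H) (w X) := lt_min hpos hXpos
    have hnew := vertexWeights_exchange hw hHX hεpos.le (min_le_left _ _) (min_le_right _ _)
      hcH hcX hHr hXr hsum
    -- The exchange takes positive weight off `H ∈ 𝒞` and adds weight only outside `𝒞`,
    -- contradicting minimality; if `X ∈ 𝒞`, the loss is even greater.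
    have hle' := hmin hnew
    have hs : ∀ Z : Finset ι, ∑ Y ∈ 𝒞, (Pi.single Z (min (w H) (w X)) : Finset ι → ℝ) Y =
        if Z ∈ 𝒞 then min (w H) (w X) else 0 := fun Z => by
      simp [Pi.single_apply, Finset.sum_ite_eq']
    simp only [Set.mem_ofPred_eq, Pi.add_apply, Pi.sub_apply, Finset.sum_add_distrib,
      Finset.sum_sub_distrib, hs, hH, hHC, haC, if_true, if_false] at hle'
    have : (0 : ℝ) ≤ if X ∈ 𝒞 then min (w H) (w X) else 0 := by split_ifs <;> simp [hεpos.le]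
    linarith
  have hxsum : x = ∑ X, w X • indicatorVector X := by
    ext i
    simp [← hw.2.2.2 i]
  rw [hxsum]
  have hsub : ∑ X, w X • (indicatorVector X : ι → ℝ) =
      ∑ X ∈ Finset.univ.filter (fun X : Finset ι => X.card = r ∧ X ∉ 𝒞),
        w X • indicatorVector X := by
    symm
    apply Finset.sum_subset (Finset.filter_subset _ _)
    intro X _ hX
    have : w X = 0 := by
      by_cases h : X ∈ 𝒞
      · exact hzero X h
      · exact hw.2.2.1 X (fun hc => hX (by simp [hc, h]))
    simp [this]
  rw [hsub]
  refine (convex_convexHull ℝ _).sum_mem (fun X _ => hw.1 X) ?_ fun X hX => ?_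
  · rw [← hw.2.1]
    apply Finset.sum_subset (Finset.filter_subset _ _)
    intro X _ hX
    by_cases h : X ∈ 𝒞
    · exact hzero X h
    · exact hw.2.2.1 X (fun hc => hX (by simp [hc, h]))
  · exact subset_convexHull ℝ _ ⟨X, by simpa using hX, rfl⟩

end

/-! ### Null hyperplanes and the order simplices of the unit cube -/

theorem volume_setOf_dotProduct_eq {n : ℕ} (a : Fin n → ℝ) (ha : a ≠ 0) (c : ℝ) :
    volume {y : Fin n → ℝ | ∑ i, a i * y i = c} = 0 := by
  obtain ⟨j, hj⟩ := Function.ne_iff.1 ha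
  let f : (Fin n → ℝ) →ₗ[ℝ] ℝ := ∑ i, a i • LinearMap.proj i
  have hf : ∀ y, f y = ∑ i, a i * y i := fun y => by simp [f]
  let s : AffineSubspace ℝ (Fin n → ℝ) :=
    (AffineSubspace.mk' c ⊥).comap f.toAffineMap
  have hs : (s : Set (Fin n → ℝ)) = {y | ∑ i, a i * y i = c} := by
    ext y
    simp [s, hf, sub_eq_zero]
  rw [← hs]
  apply Measure.addHaar_affineSubspace
  intro htop
  have h1 : ∀ y : Fin n → ℝ, ∑ i, a i * y i = c := fun y => by
    have : y ∈ (s : Set (Fin n → ℝ)) := by rw [htop]; trivial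
    rwa [hs] at this
  have h0 := h1 0
  have h2 := h1 (Pi.single j 1)
  simp [Pi.single_apply] at h0 h2
  exact hj (by simp [h2, ← h0])

theorem volume_setOf_apply_eq_apply {n : ℕ} {i j : Fin n} (hij : i ≠ j) :
    volume {y : Fin n → ℝ | y i = y j} = 0 := by
  convert volume_setOf_dotProduct_eq (Pi.single i 1 - Pi.single j 1) ?_ 0 using 3 with y
  · simp [sub_mul, Pi.single_apply, sub_eq_zero]
  · intro h
    simpa [hij] using congrFun h i

/-- The half-open unit cube. -/
def unitCube (n : ℕ) : Set (Fin n → ℝ) := Set.pi Set.univ fun _ => Set.Ico 0 1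

theorem mem_unitCube {n : ℕ} {y : Fin n → ℝ} : y ∈ unitCube n ↔ ∀ i, 0 ≤ y i ∧ y i < 1 := by
  simp [unitCube, Set.mem_pi]

theorem measurableSet_unitCube (n : ℕ) : MeasurableSet (unitCube n) :=
  MeasurableSet.univ_pi fun _ => measurableSet_Ico

theorem volume_unitCube (n : ℕ) : volume (unitCube n) = 1 := by
  rw [unitCube, volume_pi, Measure.pi_pi]
  simp

/-- The points of the unit cube whose coordinates are ordered as the values of `τ`. -/
def orderSimplex {n : ℕ} (τ : Equiv.Perm (Fin n)) : Set (Fin n → ℝ) :=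
  {x | x ∈ unitCube n ∧ ∀ i j, x i < x j ↔ τ i < τ j}

theorem measurableSet_orderSimplex {n : ℕ} (τ : Equiv.Perm (Fin n)) :
    MeasurableSet (orderSimplex τ) := by
  have : orderSimplex τ = unitCube n ∩ ⋂ i, ⋂ j, {x | x i < x j ↔ τ i < τ j} := by
    ext x; simp [orderSimplex]
  rw [this]
  refine (measurableSet_unitCube n).inter (MeasurableSet.iInter fun i =>
    MeasurableSet.iInter fun j => ?_)
  have hlt : MeasurableSet {x : Fin n → ℝ | x i < x j} :=
    measurableSet_lt (measurable_pi_apply i) (measurable_pi_apply j)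
  by_cases h : τ i < τ j
  · simpa [h] using hlt
  · simpa only [h, iff_false] using! hlt.compl

/-- Permuting the coordinates by `τ` preserves volume and carries one simplex to the other. -/
theorem volume_orderSimplex_eq {n : ℕ} (τ : Equiv.Perm (Fin n)) :
    volume (orderSimplex τ) = volume (orderSimplex (1 : Equiv.Perm (Fin n))) := by
  rw [← (volume_measurePreserving_piCongrLeft (fun _ : Fin n => ℝ) τ).measure_preimage_equiv
    (orderSimplex 1)]
  congr 1
  ext x
  have hx : ∀ i, MeasurableEquiv.piCongrLeft (fun _ : Fin n => ℝ) τ x (τ i) = x i := fun i =>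
    Equiv.piCongrLeft_apply_apply (fun _ : Fin n => ℝ) τ x i
  simp only [orderSimplex, mem_unitCube, Set.mem_preimage, Set.mem_ofPred_eq]
  refine and_congr ⟨fun h i => ?_, fun h i => ?_⟩ ⟨fun h i j => ?_, fun h i j => ?_⟩
  · obtain ⟨i, rfl⟩ := τ.surjective i
    rw [hx]
    exact h i
  · rw [← hx]
    exact h (τ i)
  · obtain ⟨i, rfl⟩ := τ.surjective i
    obtain ⟨j, rfl⟩ := τ.surjective j
    rw [hx, hx]
    exact h i j
  · rw [← hx i, ← hx j]
    exact h (τ i) (τ j)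

theorem disjoint_orderSimplex {n : ℕ} {τ σ : Equiv.Perm (Fin n)} (h : τ ≠ σ) :
    Disjoint (orderSimplex τ) (orderSimplex σ) := by
  rw [Set.disjoint_left]
  rintro x ⟨-, hτ⟩ ⟨-, hσ⟩
  apply h
  have hmono : StrictMono (σ * τ⁻¹ : Equiv.Perm (Fin n)) := by
    intro i j hij
    have := (hσ (τ⁻¹ i) (τ⁻¹ j)).1 ((hτ _ _).2 (by simpa using hij))
    simpa using this
  -- A strictly monotone permutation of `Fin n` is an order automorphism, and the identity is the
  -- only one.
  have hid : ∀ i, (σ * τ⁻¹ : Equiv.Perm (Fin n)) i = i := fun i => by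
    have := congrFun (Subsingleton.elim
      (hmono.orderIsoOfSurjective _ (Equiv.surjective _) : Fin n ≃o Fin n) (OrderIso.refl _) ▸ rfl :
      ((hmono.orderIsoOfSurjective _ (Equiv.surjective _) : Fin n ≃o Fin n) : Fin n → Fin n) =
        (OrderIso.refl _ : Fin n ≃o Fin n)) i
    simpa using this
  have : σ * τ⁻¹ = 1 := Equiv.ext hid
  exact (mul_inv_eq_one.1 this).symm

theorem volume_iUnion_orderSimplex {n : ℕ} (T : Finset (Equiv.Perm (Fin n))) :
    volume (⋃ τ ∈ T, orderSimplex τ) =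
      T.card * volume (orderSimplex (1 : Equiv.Perm (Fin n))) := by
  rw [measure_biUnion_finset (fun τ _ σ _ h => disjoint_orderSimplex h)
    fun τ _ => measurableSet_orderSimplex τ]
  simp [volume_orderSimplex_eq]

theorem exists_mem_orderSimplex {n : ℕ} {x : Fin n → ℝ} (hx : x ∈ unitCube n)
    (hinj : Function.Injective x) : ∃ τ, x ∈ orderSimplex τ := by
  refine ⟨(Tuple.sort x)⁻¹, hx, fun i j => ?_⟩
  have hmono : StrictMono (x ∘ Tuple.sort x) :=
    (Tuple.monotone_sort x).strictMono_of_injective (hinj.comp (Equiv.injective _))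
  have := hmono.lt_iff_lt (a := (Tuple.sort x)⁻¹ i) (b := (Tuple.sort x)⁻¹ j)
  simpa using this

theorem ae_injective (n : ℕ) : ∀ᵐ x : Fin n → ℝ, Function.Injective x := by
  have : ∀ᵐ x : Fin n → ℝ, ∀ i j, i ≠ j → x i ≠ x j := by
    rw [ae_all_iff]; intro i
    rw [ae_all_iff]; intro j
    by_cases h : i = j
    · simp [h]
    · have := volume_setOf_apply_eq_apply h
      rw [ae_iff]
      simpa [h] using this
  filter_upwards [this] with x hx i j hij
  by_contra h
  exact hx i j h hij

/-- Up to the null set of points with ties, `n!` disjoint simplices of equal volume fill the cube.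
-/
theorem volume_orderSimplex_one (n : ℕ) :
    volume (orderSimplex (1 : Equiv.Perm (Fin n))) = ENNReal.ofReal (1 / n.factorial) := by
  have h := volume_iUnion_orderSimplex (Finset.univ : Finset (Equiv.Perm (Fin n)))
  have h1 : (⋃ τ ∈ (Finset.univ : Finset (Equiv.Perm (Fin n))), orderSimplex τ) =ᵐ[volume]
      unitCube n := by
    filter_upwards [ae_injective n] with x hx
    refine propext ⟨?_, fun h => ?_⟩
    · intro h
      obtain ⟨τ, -, hτ⟩ := Set.mem_iUnion₂.1 h
      exact hτ.1
    · obtain ⟨τ, hτ⟩ := exists_mem_orderSimplex h hx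
      exact Set.mem_biUnion (Finset.mem_univ τ) hτ
  rw [measure_congr h1, volume_unitCube, Finset.card_univ, Fintype.card_perm, Fintype.card_fin] at h
  have hpos : (n.factorial : ENNReal) ≠ 0 := by exact_mod_cast n.factorial_ne_zero
  rw [one_div, ENNReal.ofReal_inv_of_pos (by exact_mod_cast n.factorial_pos),
    ENNReal.ofReal_natCast]
  exact ENNReal.eq_inv_of_mul_eq_one_left (by rw [mul_comm]; exact h.symm)

/-- The number of descents of a finite sequence. -/
def sequenceDescents {α : Type*} [LinearOrder α] {n : ℕ} (x : Fin n → α) : ℕ :=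
  (Finset.univ.filter
    (fun i : Fin n => ∃ h : (i : ℕ) + 1 < n, x ⟨(i : ℕ) + 1, h⟩ < x i)).card

theorem sequenceDescents_of_mem_orderSimplex {n : ℕ} {x : Fin n → ℝ} {τ : Equiv.Perm (Fin n)}
    (hx : x ∈ orderSimplex τ) : sequenceDescents x = descentCount τ := by
  unfold sequenceDescents descentCount
  congr 1
  apply Finset.filter_congr
  intro i _
  simp only [hx.2]

theorem volume_sequenceDescents_eq (n d : ℕ) :
    volume {x : Fin n → ℝ | x ∈ unitCube n ∧ sequenceDescents x = d} =
      ENNReal.ofReal (eulerianNumber n d / n.factorial) := by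
  have h1 : (⋃ τ ∈ Finset.univ.filter (fun σ : Equiv.Perm (Fin n) => descentCount σ = d),
      orderSimplex τ) =ᵐ[volume]
      {x : Fin n → ℝ | x ∈ unitCube n ∧ sequenceDescents x = d} := by
    filter_upwards [ae_injective n] with x hx
    refine propext ⟨fun h => ?_, fun h => ?_⟩
    · obtain ⟨τ, hd, hτ⟩ := Set.mem_iUnion₂.1 h
      exact ⟨hτ.1, by rw [sequenceDescents_of_mem_orderSimplex hτ, (Finset.mem_filter.1 hd).2]⟩
    · obtain ⟨τ, hτ⟩ := exists_mem_orderSimplex h.1 hx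
      refine Set.mem_biUnion (x := τ) ?_ hτ
      simp [← sequenceDescents_of_mem_orderSimplex hτ, h.2]
  rw [← measure_congr h1, volume_iUnion_orderSimplex, volume_orderSimplex_one, eulerianNumber,
    div_eq_mul_one_div (Nat.cast _), ENNReal.ofReal_mul (by positivity), ENNReal.ofReal_natCast]

/-! ### Stanley's cut and paste for slices of the cube -/

theorem sequenceDescents_succ {α : Type*} [LinearOrder α] {m : ℕ} (x : Fin (m + 1) → α) :
    sequenceDescents x = ∑ i : Fin m, if x i.succ < x i.castSucc then 1 else 0 := by
  rw [sequenceDescents, Finset.card_filter, Fin.sum_univ_castSucc]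
  simp [Fin.succ]

theorem measurable_sequenceDescents (m : ℕ) :
    Measurable (fun x : Fin (m + 1) → ℝ => sequenceDescents x) := by
  simp_rw [sequenceDescents_succ]
  refine Finset.measurable_sum _ fun i _ => Measurable.ite ?_ measurable_const measurable_const
  exact measurableSet_lt (measurable_pi_apply _) (measurable_pi_apply _)

/-- An integer matrix of determinant `1` permutes the translates of the unit cube, up to
measure-preserving cut and paste. -/
theorem volume_unitCube_inter_preimage_mulVec {n : ℕ} (M : Matrix (Fin n) (Fin n) ℤ)
    (hM : M.det = 1) {A : Set (Fin n → ℝ)} (hA : MeasurableSet A)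
    (hinv : ∀ (k : Fin n → ℤ) (x : Fin n → ℝ), (fun i => (k i : ℝ) + x i) ∈ A ↔ x ∈ A) :
    volume {y | y ∈ unitCube n ∧ (M.map (Int.cast : ℤ → ℝ)).mulVec y ∈ A} =
      volume (A ∩ unitCube n) := by
  have hu : IsUnit M.det := by rw [hM]; exact isUnit_one
  set Mr := M.map (Int.cast : ℤ → ℝ)
  set Nr := M⁻¹.map (Int.cast : ℤ → ℝ)
  have hMN : Mr * Nr = 1 := by
    refine (Matrix.map_mul (f := Int.castRingHom ℝ)).symm.trans ?_
    rw [M.mul_nonsing_inv hu]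
    simp
  have hNM : Nr * Mr = 1 := by
    refine (Matrix.map_mul (f := Int.castRingHom ℝ)).symm.trans ?_
    rw [M.nonsing_inv_mul hu]
    simp
  let e : (Fin n → ℝ) ≃ₗ[ℝ] (Fin n → ℝ) := Matrix.toLin'OfInv hNM hMN
  have he : ∀ y, e y = Mr.mulVec y := fun y => rfl
  have hes : ∀ y, e.symm y = Nr.mulVec y := fun y => rfl
  have hdet : LinearMap.det (e : (Fin n → ℝ) →ₗ[ℝ] (Fin n → ℝ)) = 1 := by
    have : (e : (Fin n → ℝ) →ₗ[ℝ] (Fin n → ℝ)) = Matrix.toLin' Mr := rfl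
    rw [this, LinearMap.det_toLin']
    have := (Int.castRingHom ℝ).map_det M
    rw [hM, map_one] at this
    exact this.symm
  set Λ := Submodule.span ℤ (Set.range (Pi.basisFun ℝ (Fin n)))
  have hΛ : ∀ x, x ∈ Λ ↔ ∃ k : Fin n → ℤ, x = fun i => (k i : ℝ) := fun x => by
    rw [Module.Basis.mem_span_iff_repr_mem]
    constructor
    · intro h
      choose k hk using h
      exact ⟨k, funext fun i => by simpa using (hk i).symm⟩
    · rintro ⟨k, rfl⟩ i
      exact ⟨k i, by simp⟩
  have hintegral : ∀ (X : Matrix (Fin n) (Fin n) ℤ), ∀ x ∈ Λ,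
      (X.map (Int.cast : ℤ → ℝ)).mulVec x ∈ Λ := by
    intro X x hx
    obtain ⟨k, rfl⟩ := (hΛ x).1 hx
    refine (hΛ _).2 ⟨X.mulVec k, ?_⟩
    ext i
    simp [Matrix.mulVec, dotProduct]
  let b := (Pi.basisFun ℝ (Fin n)).map e
  -- `M` and its inverse both have integer entries, so `M` maps `ℤⁿ` onto itself.
  have hspan : Submodule.span ℤ (Set.range b) = Λ := by
    apply le_antisymm
    · rw [Submodule.span_le]
      rintro _ ⟨i, rfl⟩
      exact hintegral M _ (Submodule.subset_span ⟨i, rfl⟩)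
    · intro x hx
      have h1 := hintegral M⁻¹ x hx
      have h2 : x = e (Nr.mulVec x) := (e.apply_symm_apply x).symm
      have h3 : ∀ z ∈ Λ, e z ∈ Submodule.span ℤ (Set.range b) := by
        intro z hz
        induction hz using Submodule.span_induction with
        | mem z hz =>
          obtain ⟨i, rfl⟩ := hz
          exact Submodule.subset_span ⟨i, by simp [b]⟩
        | zero => simp
        | add u v _ _ hu hv => rw [map_add]; exact add_mem hu hv
        | smul c u _ hu => rw [map_zsmul]; exact Submodule.smul_mem _ c hu
      rw [h2]
      exact h3 _ h1
  have hF₁ : IsAddFundamentalDomain Λ (unitCube n) volume := by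
    have := ZSpan.isAddFundamentalDomain (Pi.basisFun ℝ (Fin n)) volume
    rwa [ZSpan.fundamentalDomain_pi_basisFun] at this
  -- The cube and its image under `M` are both fundamental domains of `ℤⁿ`, so the `ℤⁿ`-invariant
  -- set `A` meets them in equal volume. Determinant one then transfers the image back to the cube.
  have hF₂ : IsAddFundamentalDomain Λ (e '' unitCube n) volume := by
    have := ZSpan.isAddFundamentalDomain b volume
    rw [hspan, ← ZSpan.map_fundamentalDomain, ZSpan.fundamentalDomain_pi_basisFun] at this
    exact this
  have hset : e '' {y | y ∈ unitCube n ∧ Mr.mulVec y ∈ A} = A ∩ e '' unitCube n := by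
    ext x
    constructor
    · rintro ⟨y, ⟨hy, hyA⟩, rfl⟩
      exact ⟨hyA, y, hy, rfl⟩
    · rintro ⟨hxA, y, hy, rfl⟩
      exact ⟨y, ⟨hy, hxA⟩, rfl⟩
  have hvol := Measure.addHaar_image_linearMap volume (e : (Fin n → ℝ) →ₗ[ℝ] (Fin n → ℝ))
    {y | y ∈ unitCube n ∧ Mr.mulVec y ∈ A}
  rw [hdet, abs_one, ENNReal.ofReal_one, one_mul] at hvol
  rw [← hvol]
  change volume (e '' _) = _
  rw [hset]
  have : VAddInvariantMeasure Λ (Fin n → ℝ) volume :=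
    inferInstanceAs (VAddInvariantMeasure Λ.toAddSubgroup (Fin n → ℝ) volume)
  refine hF₂.measure_set_eq hF₁ hA fun g => ?_
  obtain ⟨k, hk⟩ := (hΛ g).1 g.2
  ext x
  rw [Set.mem_preimage, ← hinv k x]
  have : g +ᵥ x = fun i => (k i : ℝ) + x i := by
    rw [Submodule.vadd_def, hk]; rfl
  rw [this]

/-- An increment in `[0, 1)` raises the floor by one exactly when the fractional part drops, and
otherwise leaves it unchanged. -/
theorem floor_eq_sum_fract_lt (s : ℕ → ℝ) (h0 : 0 ≤ s 0 ∧ s 0 < 1)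
    (hs : ∀ k, 0 ≤ s (k + 1) - s k ∧ s (k + 1) - s k < 1) (m : ℕ) :
    ⌊s m⌋ = ∑ k ∈ Finset.range m, if Int.fract (s (k + 1)) < Int.fract (s k) then 1 else 0 := by
  induction m with
  | zero => simpa [Int.floor_eq_zero_iff] using h0
  | succ m ih =>
    rw [Finset.sum_range_succ, ← ih]
    obtain ⟨h1, h2⟩ := hs m
    have e1 := Int.floor_add_fract (s m)
    have e2 := Int.floor_add_fract (s (m + 1))
    have a1 := Int.fract_nonneg (s m)
    have a2 := Int.fract_lt_one (s m)
    have b1 := Int.fract_nonneg (s (m + 1))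
    have b2 := Int.fract_lt_one (s (m + 1))
    split_ifs with h
    · have c1 : (⌊s m⌋ : ℝ) < ⌊s (m + 1)⌋ := by linarith
      have c2 : (⌊s (m + 1)⌋ : ℝ) < ⌊s m⌋ + 2 := by linarith
      norm_cast at c1 c2
      omega
    · push Not at h
      have c1 : (⌊s m⌋ : ℝ) < ⌊s (m + 1)⌋ + 1 := by linarith
      have c2 : (⌊s (m + 1)⌋ : ℝ) < ⌊s m⌋ + 1 := by linarith
      norm_cast at c1 c2
      omega

/-- The matrix that sends a sequence to its partial sums. -/
def partialSumMatrix (n : ℕ) : Matrix (Fin n) (Fin n) ℤ :=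
  Matrix.of fun i j => if j ≤ i then 1 else 0

theorem det_partialSumMatrix (n : ℕ) : (partialSumMatrix n).det = 1 := by
  rw [Matrix.det_of_isLowerTriangular]
  · simp [partialSumMatrix]
  · intro i j hij
    simpa [partialSumMatrix] using hij

theorem floor_sum_eq_sequenceDescents {m : ℕ} {y : Fin (m + 1) → ℝ} (hy : y ∈ unitCube (m + 1)) :
    ⌊∑ i, y i⌋ = (sequenceDescents fun i =>
      Int.fract (((partialSumMatrix (m + 1)).map (Int.cast : ℤ → ℝ)).mulVec y i) : ℤ) := by
  rw [mem_unitCube] at hy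
  -- Padding by `0` keeps every increment of the partial sums in `[0, 1)`, as the `ℕ`-indexed lemma
  -- demands.
  let y' : ℕ → ℝ := fun j => if h : j < m + 1 then y ⟨j, h⟩ else 0
  have hy' : ∀ j, 0 ≤ y' j ∧ y' j < 1 := by
    intro j
    dsimp only [y']
    split_ifs with h
    · exact hy ⟨j, h⟩
    · simp
  have hyy : ∀ i : Fin (m + 1), y i = y' i := fun i => by
    dsimp only [y']
    rw [dif_pos i.2]
  let s : ℕ → ℝ := fun k => ∑ j ∈ Finset.range (k + 1), y' j
  have hmul : ∀ i : Fin (m + 1),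
      ((partialSumMatrix (m + 1)).map (Int.cast : ℤ → ℝ)).mulVec y i = s i := by
    intro i
    have h1 : ((partialSumMatrix (m + 1)).map (Int.cast : ℤ → ℝ)).mulVec y i =
        ∑ j : Fin (m + 1), if (j : ℕ) ≤ i then y' j else 0 := by
      simp only [Matrix.mulVec, dotProduct, partialSumMatrix, Matrix.map_apply, Matrix.of_apply]
      refine Finset.sum_congr rfl fun j _ => ?_
      by_cases h : j ≤ i
      · have h' : (j : ℕ) ≤ i := h
        simp [h, h', hyy]
      · have h' : ¬ (j : ℕ) ≤ i := h
        simp [h, h']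
    rw [h1, Fin.sum_univ_eq_sum_range (fun j => if j ≤ (i : ℕ) then y' j else 0),
      ← Finset.sum_filter]
    refine Finset.sum_congr ?_ fun _ _ => rfl
    ext j
    have := i.2
    simp
    omega
  have hfloor := floor_eq_sum_fract_lt s (by simpa [s] using hy' 0)
    (fun k => by simpa [s, Finset.sum_range_succ _ (k + 1)] using hy' (k + 1)) m
  have hsum : ∑ i, y i = s m := by
    simp_rw [hyy, s]
    exact Fin.sum_univ_eq_sum_range y' (m + 1)
  rw [hsum, hfloor, sequenceDescents_succ]
  simp_rw [hmul]
  push_cast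
  rw [← Fin.sum_univ_eq_sum_range
    (fun k => if Int.fract (s (k + 1)) < Int.fract (s k) then (1 : ℤ) else 0)]
  simp

/-- The volume of the slice `d ≤ ∑ y < d + 1` of the unit cube, by Stanley's cut and paste. -/
theorem volume_unitCube_slice (m d : ℕ) :
    volume {y : Fin (m + 1) → ℝ | y ∈ unitCube (m + 1) ∧ (d : ℝ) ≤ ∑ i, y i ∧
      ∑ i, y i < d + 1} = ENNReal.ofReal (eulerianNumber (m + 1) d / (m + 1).factorial) := by
  let A : Set (Fin (m + 1) → ℝ) := {z | sequenceDescents (fun i => Int.fract (z i)) = d}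
  have hA : MeasurableSet A := by
    have hm : Measurable fun z : Fin (m + 1) → ℝ => sequenceDescents fun i => Int.fract (z i) :=
      (measurable_sequenceDescents m).comp
        (measurable_pi_lambda _ fun i => measurable_fract.comp (measurable_pi_apply i))
    exact hm (measurableSet_singleton d)
  have h := volume_unitCube_inter_preimage_mulVec (partialSumMatrix (m + 1))
    (det_partialSumMatrix _) hA (fun k x => by simp [A])
  have h1 : A ∩ unitCube (m + 1) = {x | x ∈ unitCube (m + 1) ∧ sequenceDescents x = d} := by
    ext x
    have : x ∈ unitCube (m + 1) → (fun i => Int.fract (x i)) = x := fun hx =>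
      funext fun i => Int.fract_eq_self.2 (mem_unitCube.1 hx i)
    constructor
    · rintro ⟨hx, hc⟩
      refine ⟨hc, ?_⟩
      rwa [← this hc]
    · rintro ⟨hc, hx⟩
      refine ⟨?_, hc⟩
      change sequenceDescents (fun i => Int.fract (x i)) = d
      rwa [this hc]
  rw [h1, volume_sequenceDescents_eq] at h
  rw [← h]
  congr 1
  ext y
  refine and_congr_right fun hy => ?_
  change _ ↔ sequenceDescents _ = d
  rw [← Nat.cast_inj (R := ℤ), ← floor_sum_eq_sequenceDescents hy, Int.floor_eq_iff]
  simp

/-! ### Simplices and pyramids in the orthant -/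

theorem setLIntegral_Icc_pow (q : ℕ) (c : ℝ) (hc : 0 ≤ c) {w : ℝ} (hw : 0 ≤ w) :
    ∫⁻ s in Set.Icc 0 w, ENNReal.ofReal (s ^ q / c) =
      ENNReal.ofReal (w ^ (q + 1) / ((q + 1) * c)) := by
  rw [← ofReal_integral_eq_lintegral_ofReal]
  · congr 1
    rw [integral_Icc_eq_integral_Ioc, ← intervalIntegral.integral_of_le hw,
      intervalIntegral.integral_div, integral_pow]
    simp [div_div]
  · exact (ContinuousOn.integrableOn_Icc (by fun_prop))
  · filter_upwards [ae_restrict_mem measurableSet_Icc] with s hs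
    exact div_nonneg (pow_nonneg hs.1 _) hc

/-- Induction by splitting off one coordinate `t`. With `u` the sum of the others, integrating out
`t` leaves the function `u ↦ ∫_{w ≥ u} f w`, to which the induction hypothesis applies; Tonelli on
`0 ≤ s ≤ w` then integrates `s ^ q / q!` to `w ^ (q+1) / (q+1)!`. -/
theorem setLIntegral_orthant_comp_sum_fin (q : ℕ) (f : ℝ → ENNReal) (hf : Measurable f) :
    ∫⁻ v in {v : Fin (q + 1) → ℝ | ∀ i, 0 ≤ v i}, f (∑ i, v i) =
      ∫⁻ s in Set.Ici 0, f s * ENNReal.ofReal (s ^ q / q.factorial) := by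
  induction q generalizing f with
  | zero =>
    have h := (volume_preserving_funUnique (Fin 1) ℝ).setLIntegral_comp_preimage_emb
      (MeasurableEquiv.measurableEmbedding _) f (Set.Ici 0)
    simp only [pow_zero, Nat.factorial_zero, Nat.cast_one, div_one, ENNReal.ofReal_one,
      mul_one]
    rw [← h]
    have hs : {v : Fin 1 → ℝ | ∀ i, 0 ≤ v i} =
        (MeasurableEquiv.funUnique (Fin 1) ℝ) ⁻¹' Set.Ici 0 := by
      ext v
      simp [MeasurableEquiv.funUnique]
    rw [hs]
    simp [MeasurableEquiv.funUnique]
    rfl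
  | succ q ih =>
    have h := (volume_preserving_piFinSuccAbove (fun _ : Fin (q + 1 + 1) => ℝ)
      0).setLIntegral_comp_preimage_emb (MeasurableEquiv.measurableEmbedding _)
      (fun z => f (z.1 + ∑ i, z.2 i)) (Set.Ici 0 ×ˢ {v | ∀ i, 0 ≤ v i})
    have hs : {v : Fin (q + 1 + 1) → ℝ | ∀ i, 0 ≤ v i} =
        (MeasurableEquiv.piFinSuccAbove (fun _ : Fin (q + 1 + 1) => ℝ) 0) ⁻¹'
          (Set.Ici 0 ×ˢ {v | ∀ i, 0 ≤ v i}) := by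
      ext v
      simp [MeasurableEquiv.piFinSuccAbove, Fin.forall_fin_succ, Fin.tail, Fin.insertNthEquiv]
    have hsum : ∀ v : Fin (q + 1 + 1) → ℝ, ∑ i, v i =
        (MeasurableEquiv.piFinSuccAbove (fun _ : Fin (q + 1 + 1) => ℝ) 0 v).1 +
        ∑ i, (MeasurableEquiv.piFinSuccAbove (fun _ : Fin (q + 1 + 1) => ℝ) 0 v).2 i := by
      intro v
      simp [MeasurableEquiv.piFinSuccAbove, Fin.sum_univ_succ, Fin.tail, Fin.insertNthEquiv]
    rw [hs]
    simp_rw [hsum]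
    have hfm : Measurable fun z : ℝ × (Fin (q + 1) → ℝ) => f (z.1 + ∑ i, z.2 i) :=
      hf.comp (by fun_prop)
    rw [h, Measure.volume_eq_prod, ← Measure.prod_restrict, lintegral_prod_symm _ hfm.aemeasurable]
    have hF : Measurable fun u : ℝ => ∫⁻ t in Set.Ici (0 : ℝ), f (t + u) :=
      (hf.comp (measurable_fst.add measurable_snd)).lintegral_prod_left'
    rw [ih (fun u => ∫⁻ t in Set.Ici (0 : ℝ), f (t + u)) hF]
    have hshift : ∀ u : ℝ, ∫⁻ t in Set.Ici (0 : ℝ), f (t + u) = ∫⁻ w in Set.Ici u, f w := by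
      intro u
      rw [← (measurePreserving_add_right volume u).setLIntegral_comp_preimage_emb
        (MeasurableEquiv.addRight u).measurableEmbedding f (Set.Ici u)]
      simp
    simp_rw [hshift]
    set G : ℝ → ENNReal := fun s => ENNReal.ofReal (s ^ q / q.factorial) with hG
    have hGm : Measurable G := by fun_prop
    let k : ℝ → ℝ → ENNReal := fun s w =>
      {z : ℝ × ℝ | 0 ≤ z.1 ∧ z.1 ≤ z.2}.indicator (fun z => f z.2 * G z.1) (s, w)
    have hk : Measurable (Function.uncurry k) := by
      have : MeasurableSet {z : ℝ × ℝ | 0 ≤ z.1 ∧ z.1 ≤ z.2} :=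
        (measurableSet_le measurable_const measurable_fst).inter
          (measurableSet_le measurable_fst measurable_snd)
      exact Measurable.indicator (by fun_prop) this
    have h1 : ∫⁻ s in Set.Ici (0 : ℝ), (∫⁻ w in Set.Ici s, f w) * G s = ∫⁻ s, ∫⁻ w, k s w := by
      rw [← lintegral_indicator measurableSet_Ici]
      refine lintegral_congr fun s => ?_
      by_cases hs : 0 ≤ s
      · rw [Set.indicator_of_mem (Set.mem_Ici.2 hs), ← lintegral_mul_const _ hf,
          ← lintegral_indicator measurableSet_Ici]
        refine lintegral_congr fun w => ?_
        simp [k, Set.indicator_apply, hs]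
      · rw [Set.indicator_of_notMem (by simpa using hs)]
        simp [k, hs]
    have h2 : ∫⁻ w in Set.Ici (0 : ℝ), f w * ENNReal.ofReal (w ^ (q + 1) / (q + 1).factorial) =
        ∫⁻ w, ∫⁻ s, k s w := by
      rw [← lintegral_indicator measurableSet_Ici]
      refine lintegral_congr fun w => ?_
      by_cases hw : 0 ≤ w
      · rw [Set.indicator_of_mem (Set.mem_Ici.2 hw), Nat.factorial_succ]
        push_cast
        rw [← setLIntegral_Icc_pow q _ (by positivity) hw, ← lintegral_const_mul _ hGm,
          ← lintegral_indicator measurableSet_Icc]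
        refine lintegral_congr fun s => ?_
        simp [k, Set.indicator_apply, G]
      · rw [Set.indicator_of_notMem (by simpa using hw)]
        have : ∀ s, k s w = 0 := fun s => by
          simp only [k, Set.indicator_apply, Set.mem_ofPred_eq]
          rw [if_neg]
          rintro ⟨h1, h2⟩
          exact hw (h1.trans h2)
        simp [this]
    rw [h1, h2, lintegral_lintegral_swap hk.aemeasurable]

/-- The sum of the coordinates pushes Lebesgue measure on the orthant of `ℝ^(q+1)` forward to
`s ^ q / q! ds`. -/
theorem setLIntegral_orthant_comp_sum {κ : Type*} [Fintype κ] {q : ℕ}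
    (hκ : Fintype.card κ = q + 1) (f : ℝ → ENNReal) (hf : Measurable f) :
    ∫⁻ v in {v : κ → ℝ | ∀ i, 0 ≤ v i}, f (∑ i, v i) =
      ∫⁻ s in Set.Ici 0, f s * ENNReal.ofReal (s ^ q / q.factorial) := by
  let e : Fin (q + 1) ≃ κ := (Fintype.equivFinOfCardEq hκ).symm
  rw [← setLIntegral_orthant_comp_sum_fin q f hf,
    ← (volume_measurePreserving_piCongrLeft (fun _ : κ => ℝ) e).setLIntegral_comp_preimage_emb
      (MeasurableEquiv.measurableEmbedding _)]
  have he : ∀ (x : Fin (q + 1) → ℝ) i,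
      MeasurableEquiv.piCongrLeft (fun _ : κ => ℝ) e x (e i) = x i := fun x i =>
    Equiv.piCongrLeft_apply_apply (fun _ : κ => ℝ) e x i
  have hs : (MeasurableEquiv.piCongrLeft (fun _ : κ => ℝ) e) ⁻¹' {v : κ → ℝ | ∀ i, 0 ≤ v i} =
      {v | ∀ i, 0 ≤ v i} := by
    ext x
    simp only [Set.mem_preimage, Set.mem_ofPred_eq]
    rw [← e.forall_congr_right]
    simp [he]
  rw [hs]
  refine lintegral_congr fun x => ?_
  rw [← e.sum_comp]
  simp [he]

theorem measurableSet_orthant (κ : Type*) [Fintype κ] :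
    MeasurableSet {v : κ → ℝ | ∀ i, 0 ≤ v i} := by
  rw [Set.ofPred_forall]
  exact MeasurableSet.iInter fun i => measurableSet_le measurable_const (measurable_pi_apply i)

/-- The volume of a scaled standard simplex. -/
theorem volume_orthant_sum_le {κ : Type*} [Fintype κ] {p : ℕ} (hκ : Fintype.card κ = p) {s : ℝ}
    (hs : 0 ≤ s) :
    volume {u : κ → ℝ | (∀ i, 0 ≤ u i) ∧ ∑ i, u i ≤ s} =
      ENNReal.ofReal (s ^ p / p.factorial) := by
  cases p with
  | zero =>
    have : IsEmpty κ := Fintype.card_eq_zero_iff.1 hκ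
    have huniv : {u : κ → ℝ | (∀ i, 0 ≤ u i) ∧ ∑ i, u i ≤ s} = Set.univ := by
      ext u; simp [hs]
    rw [huniv, volume_pi, Measure.pi_of_empty]
    simp
  | succ q =>
    have h := setLIntegral_orthant_comp_sum hκ ((Set.Iic s).indicator fun _ => 1)
      (measurable_const.indicator measurableSet_Iic)
    have hm : MeasurableSet {u : κ → ℝ | ∑ i, u i ≤ s} :=
      measurableSet_le (by fun_prop) measurable_const
    have h1 : ∫⁻ v in {v : κ → ℝ | ∀ i, 0 ≤ v i}, (Set.Iic s).indicator (fun _ => 1) (∑ i, v i) =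
        volume {u : κ → ℝ | (∀ i, 0 ≤ u i) ∧ ∑ i, u i ≤ s} := by
      rw [Set.ofPred_and, Set.inter_comm, ← Measure.restrict_apply hm, ← lintegral_indicator_one hm]
      rfl
    rw [← h1, h, Nat.factorial_succ]
    push_cast
    rw [← setLIntegral_Icc_pow q _ (by positivity) hs, ← lintegral_indicator measurableSet_Ici,
      ← lintegral_indicator measurableSet_Icc]
    refine lintegral_congr fun w => ?_
    by_cases h1 : 0 ≤ w <;> by_cases h2 : w ≤ s <;> simp [h1, h2]

/-- The volume of the pyramid cut out of the orthant by `∑_{A} x ≤ ∑_{Aᶜ} x ≤ 1`. -/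
theorem volume_pyramid {ι : Type*} [Fintype ι] (A : ι → Prop) [DecidablePred A] {p q : ℕ}
    (hp : Fintype.card {i // A i} = p) (hq : Fintype.card {i // ¬ A i} = q + 1) :
    volume {x : ι → ℝ | (∀ i, 0 ≤ x i) ∧ ∑ i : {i // A i}, x i ≤ ∑ i : {i // ¬ A i}, x i ∧
      ∑ i : {i // ¬ A i}, x i ≤ 1} =
      ENNReal.ofReal (((p + q).choose p : ℝ) / (p + q + 1).factorial) := by
  have hE : MeasurableSet {z : ({i // A i} → ℝ) × ({i // ¬ A i} → ℝ) |
      ((∀ i, 0 ≤ z.1 i) ∧ ∀ i, 0 ≤ z.2 i) ∧ ∑ i, z.1 i ≤ ∑ i, z.2 i ∧ ∑ i, z.2 i ≤ 1} := by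
    have h1 : Measurable fun z : ({i // A i} → ℝ) × ({i // ¬ A i} → ℝ) => ∑ i, z.1 i := by fun_prop
    have h2 : Measurable fun z : ({i // A i} → ℝ) × ({i // ¬ A i} → ℝ) => ∑ i, z.2 i := by fun_prop
    exact ((measurable_fst (measurableSet_orthant _)).inter
      (measurable_snd (measurableSet_orthant _))).inter
      ((measurableSet_le h1 h2).inter (measurableSet_le h2 measurable_const))
  have h := (volume_preserving_piEquivPiSubtypeProd (fun _ : ι => ℝ) A).measure_preimage
    hE.nullMeasurableSet
  have hpre : (MeasurableEquiv.piEquivPiSubtypeProd (fun _ : ι => ℝ) A) ⁻¹'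
      {z : ({i // A i} → ℝ) × ({i // ¬ A i} → ℝ) |
      ((∀ i, 0 ≤ z.1 i) ∧ ∀ i, 0 ≤ z.2 i) ∧ ∑ i, z.1 i ≤ ∑ i, z.2 i ∧ ∑ i, z.2 i ≤ 1} =
      {x : ι → ℝ | (∀ i, 0 ≤ x i) ∧ ∑ i : {i // A i}, x i ≤ ∑ i : {i // ¬ A i}, x i ∧
      ∑ i : {i // ¬ A i}, x i ≤ 1} := by
    ext x
    refine and_congr ⟨fun h i => ?_, fun h => ⟨fun i => h i, fun i => h i⟩⟩ Iff.rfl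
    by_cases hi : A i
    · exact h.1 ⟨i, hi⟩
    · exact h.2 ⟨i, hi⟩
  rw [hpre] at h
  rw [h, Measure.volume_eq_prod, Measure.prod_apply_symm hE]
  -- For fixed `v` the slice is a scaled standard simplex of dimension `p`, whose volume depends on
  -- `v` only through `∑ v`.
  have hinner : ∀ v : {i // ¬ A i} → ℝ, volume ((fun u : {i // A i} → ℝ => (u, v)) ⁻¹'
      {z : ({i // A i} → ℝ) × ({i // ¬ A i} → ℝ) |
      ((∀ i, 0 ≤ z.1 i) ∧ ∀ i, 0 ≤ z.2 i) ∧ ∑ i, z.1 i ≤ ∑ i, z.2 i ∧ ∑ i, z.2 i ≤ 1}) =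
      {v : {i // ¬ A i} → ℝ | ∀ i, 0 ≤ v i}.indicator (fun v => (Set.Iic (1 : ℝ)).indicator
        (fun s => ENNReal.ofReal (s ^ p / p.factorial)) (∑ i, v i)) v := by
    intro v
    by_cases hv : ∀ i, 0 ≤ v i
    · rw [Set.indicator_of_mem (by exact hv)]
      by_cases hs : ∑ i, v i ≤ 1
      · rw [Set.indicator_of_mem (by exact hs),
          ← volume_orthant_sum_le hp (Finset.sum_nonneg fun i _ => hv i)]
        congr 1
        ext u
        simp only [Set.mem_preimage, Set.mem_ofPred_eq]
        tauto
      · rw [Set.indicator_of_notMem (by exact hs)]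
        convert measure_empty (μ := volume)
        ext u
        simp only [Set.mem_preimage, Set.mem_ofPred_eq, Set.mem_empty_iff_false]
        tauto
    · rw [Set.indicator_of_notMem (by exact hv)]
      convert measure_empty (μ := volume)
      ext u
      simp only [Set.mem_preimage, Set.mem_ofPred_eq, Set.mem_empty_iff_false]
      tauto
  simp_rw [hinner]
  rw [lintegral_indicator (measurableSet_orthant _), setLIntegral_orthant_comp_sum hq
    ((Set.Iic (1 : ℝ)).indicator (fun s => ENNReal.ofReal (s ^ p / p.factorial)))
    (Measurable.indicator (by fun_prop) measurableSet_Iic)]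
  -- The right side is `∫₀¹ s ^ (p+q) / (p! q!) ds`.
  have hval : ((p + q).choose p : ℝ) / (p + q + 1).factorial =
      1 ^ (p + q + 1) / (((p + q : ℕ) + 1) * (p.factorial * q.factorial : ℝ)) := by
    have h1 : ((p + q).choose p : ℝ) * p.factorial * q.factorial = (p + q).factorial := by
      rw [Nat.choose_symm_add]
      exact_mod_cast Nat.add_choose_mul_factorial_mul_factorial p q
    have h2 : ((p + q + 1).factorial : ℝ) = (p + q + 1) * (p + q).factorial := by
      rw [Nat.factorial_succ]; push_cast; ring
    rw [h2, one_pow, div_eq_div_iff (by positivity) (by positivity), ← h1]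
    push_cast
    ring
  rw [hval, ← setLIntegral_Icc_pow (p + q) _ (by positivity) zero_le_one,
    ← lintegral_indicator measurableSet_Ici, ← lintegral_indicator measurableSet_Icc]
  refine lintegral_congr fun s => ?_
  by_cases h0 : 0 ≤ s
  · by_cases h1 : s ≤ 1
    · rw [Set.indicator_of_mem (by exact h0), Set.indicator_of_mem (by exact h1),
        Set.indicator_of_mem (by exact ⟨h0, h1⟩), ← ENNReal.ofReal_mul (by positivity), pow_add,
        div_mul_div_comm]
    · simp [h0, h1]
  · simp [h0]

/-! ### Circuit-hyperplanes, connectedness and the base polytope -/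

namespace Matroid

section

variable {ι : Type*} {M : Matroid ι}

theorem IsCircuitHyperplane.encard_eq {H : Set ι} (hH : M.IsCircuitHyperplane H) :
    H.encard = M.eRank := by
  rw [← hH.1.eRk_add_one_eq, hH.2.2]

theorem isBase_iff_of_isSparsePaving (hE : M.E = Set.univ) (hsp : M.IsSparsePaving)
    {X : Set ι} : M.IsBase X ↔ X.encard = M.eRank ∧ ¬ M.IsCircuitHyperplane X :=
  ⟨fun h => ⟨h.encard_eq_eRank, fun hc => hc.1.not_indep h.indep⟩,
    fun h => (hsp X (by simp [hE]) h.1).resolve_right h.2⟩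

/-- A circuit-hyperplane is the closure of each of its subsets of corank one. -/
theorem IsCircuitHyperplane.closure_eq [Finite ι] {H S : Set ι} (hH : M.IsCircuitHyperplane H)
    (hS : S ⊂ H) (hcard : H.encard ≤ S.encard + 1) : M.closure S = H := by
  have hind : M.Indep S := hH.1.ssubset_indep hS
  have hfin : M.IsRkFinite S := M.isRkFinite_of_finite (Set.toFinite S)
  rw [hfin.closure_eq_closure_of_subset_of_eRk_ge_eRk hS.subset, hH.2.1.closure]
  rw [hind.eRk_eq_encard]
  rw [← hH.1.eRk_add_one_eq] at hcard
  exact (ENat.add_le_add_iff_right (by simp)).1 hcard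

/-- An intersection of corank at most one would have both `H` and `H'` as its closure. It is a
proper subset of each because circuits form an antichain. -/
theorem IsCircuitHyperplane.encard_inter_add_two_le [Finite ι] {H H' : Set ι}
    (hH : M.IsCircuitHyperplane H) (hH' : M.IsCircuitHyperplane H') (hne : H ≠ H') :
    (H ∩ H').encard + 2 ≤ M.eRank := by
  have hss : H ∩ H' ⊂ H := by
    refine Set.inter_subset_left.ssubset_of_ne fun h => hne ?_
    exact hH.1.eq_of_subset_isCircuit hH'.1 (Set.inter_eq_left.1 h)
  have hss' : H ∩ H' ⊂ H' := by
    refine Set.inter_subset_right.ssubset_of_ne fun h => hne ?_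
    exact (hH'.1.eq_of_subset_isCircuit hH.1 (Set.inter_eq_right.1 h)).symm
  by_contra hlt
  have hle : M.eRank ≤ (H ∩ H').encard + 1 := by
    rw [not_le] at hlt
    have : (H ∩ H').encard + 2 = (H ∩ H').encard + 1 + 1 := by rw [add_assoc]; norm_num
    rw [this] at hlt
    exact Order.le_of_lt_add_one hlt
  exact hne ((hH.closure_eq hss (by rw [hH.encard_eq]; exact hle)).symm.trans
    (hH'.closure_eq hss' (by rw [hH'.encard_eq]; exact hle)))

/-- In a connected matroid any two elements are exchanged by some pair of bases. -/
theorem IsConnected.exists_isBase_exchange (hE : M.E = Set.univ) (hconn : M.IsConnected)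
    {a b : ι} (hab : a ≠ b) :
    ∃ B, M.IsBase B ∧ a ∉ B ∧ b ∈ B ∧ M.IsBase (insert a (B \ {b})) := by
  obtain ⟨C, hC, haC, hbC⟩ := hconn a (by simp [hE]) b (by simp [hE]) hab
  -- Extending `C \ {a}` to a basis makes `C` the fundamental circuit of `a`, so any other element
  -- of `C`, here `b`, may be exchanged for `a`.
  obtain ⟨B, hB, hCB⟩ := (hC.sdiff_singleton_indep haC).exists_isBase_superset
  have hCi : C ⊆ insert a B := by
    rwa [← Set.sdiff_singleton_subset_iff]
  have haB : a ∉ B := fun h =>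
    hC.not_indep (hB.indep.subset (by rwa [Set.insert_eq_of_mem h] at hCi))
  have hbB : b ∈ B := hCB ⟨hbC, hab.symm⟩
  have hCf := hC.eq_fundCircuit_of_subset hB.indep hCi
  have hacl : a ∈ M.closure B := by rw [hB.closure_eq, hE]; trivial
  have hind : M.Indep (insert a B \ {b}) := by
    rw [← hB.indep.mem_fundCircuit_iff hacl haB, ← hCf]
    exact hbC
  have hset : insert a B \ {b} = insert a (B \ {b}) := by
    rw [Set.insert_sdiff_of_notMem _ (by simpa using hab)]
  rw [hset] at hind
  exact ⟨B, hB, haB, hbB, hB.exchange_isBase_of_indep haB hind⟩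

end

variable {n : ℕ} {M : Matroid (Fin (n + 1))} {d : ℕ}

/-- Connectedness on at least two elements provides a basis that misses `0`, so the rank is below `n
+ 1`. -/
theorem lt_of_isConnected_of_eRank_eq (hn : 1 ≤ n) (hE : M.E = Set.univ)
    (hrank : M.eRank = (d : ℕ∞) + 1) (hconn : M.IsConnected) : d < n := by
  have h01 : (0 : Fin (n + 1)) ≠ Fin.last n := by
    intro h
    have := congrArg Fin.val h
    simp at this
    omega
  obtain ⟨B, hB, h0, -⟩ := hconn.exists_isBase_exchange hE h01
  have hlt : B ⊂ Set.univ := by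
    rw [Set.ssubset_univ_iff]
    rintro rfl
    exact h0 trivial
  have h1 := (Set.toFinite B).encard_lt_encard hlt
  rw [hB.encard_eq_eRank, hrank, Set.encard_univ, ENat.card_eq_coe_fintype_card,
    Fintype.card_fin] at h1
  have : d + 1 < n + 1 := by exact_mod_cast h1
  omega

theorem sum_incidenceVector_of_encard {B : Set (Fin (n + 1))} (hB : B.encard = (d : ℕ∞) + 1) :
    ∑ i, incidenceVector B i = (d : ℝ) + 1 := by
  classical
  have : B.ncard = d + 1 := by
    rw [Set.ncard, hB]; rfl
  simp only [incidenceVector, Set.indicator_apply, Finset.sum_ite, Finset.sum_const_zero,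
    add_zero, Finset.sum_const, nsmul_eq_mul, mul_one]
  rw [← Nat.cast_succ, Nat.succ_eq_add_one, ← this, Set.ncard_eq_toFinset_card']
  congr 2
  ext i
  simp

theorem sum_of_mem_basePolytope (hrank : M.eRank = (d : ℕ∞) + 1)
    {x : EuclideanSpace ℝ (Fin (n + 1))} (hx : x ∈ M.basePolytope) :
    ∑ i, x i = (d : ℝ) + 1 := by
  refine convexHull_min (t := {x : EuclideanSpace ℝ (Fin (n + 1)) | ∑ i, x i = (d : ℝ) + 1})
    ?_ ?_ hx
  · rintro _ ⟨B, hB, rfl⟩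
    exact sum_incidenceVector_of_encard (hB.encard_eq_eRank.trans hrank)
  · intro x hx y hy a b _ _ hab
    simp only [Set.mem_ofPred_eq] at hx hy ⊢
    simp only [PiLp.add_apply, PiLp.smul_apply, smul_eq_mul, Finset.sum_add_distrib,
      ← Finset.mul_sum, hx, hy, ← add_mul, hab, one_mul]

theorem incidenceVector_exchange_sub {B : Set (Fin (n + 1))} {a b : Fin (n + 1)} (ha : a ∉ B)
    (hb : b ∈ B) : incidenceVector (insert a (B \ {b})) - incidenceVector B =
      EuclideanSpace.single a (1 : ℝ) - EuclideanSpace.single b 1 := by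
  classical
  have hab : a ≠ b := fun h => ha (h ▸ hb)
  ext i
  by_cases hia : i = a
  · subst hia; simp [incidenceVector, ha, hab]
  · by_cases hib : i = b
    · subst hib; simp [incidenceVector, hb, hia]
    · simp [incidenceVector, Set.indicator_apply, hia, hib]

/-- Bases exchanging `a` and `0` put `e_a - e_0` into the direction space, and these vectors span
the sum-zero hyperplane. -/
theorem vectorSpan_basePolytope (hE : M.E = Set.univ) (hrank : M.eRank = (d : ℕ∞) + 1)
    (hconn : M.IsConnected) :
    vectorSpan ℝ M.basePolytope = sumZeroSubmodule (Fin (n + 1)) := by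
  apply le_antisymm
  · rw [vectorSpan, Submodule.span_le]
    rintro _ ⟨x, hx, y, hy, rfl⟩
    rw [SetLike.mem_coe, mem_sumZeroSubmodule]
    simp [sum_of_mem_basePolytope hrank hx, sum_of_mem_basePolytope hrank hy]
  · intro v hv
    have hsingle : ∀ a : Fin (n + 1), EuclideanSpace.single a (1 : ℝ) -
        EuclideanSpace.single 0 1 ∈ vectorSpan ℝ M.basePolytope := by
      intro a
      by_cases ha : a = 0
      · simp [ha]
      · obtain ⟨B, hB, haB, hbB, hB'⟩ := hconn.exists_isBase_exchange hE ha
        rw [← incidenceVector_exchange_sub haB hbB]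
        exact vsub_mem_vectorSpan ℝ (subset_convexHull ℝ _ ⟨_, hB', rfl⟩)
          (subset_convexHull ℝ _ ⟨_, hB, rfl⟩)
    have hv0 := mem_sumZeroSubmodule.1 hv
    have hsum : v = ∑ a, v a • (EuclideanSpace.single a (1 : ℝ) - EuclideanSpace.single 0 1) := by
      ext i
      simp [smul_sub, Finset.sum_sub_distrib, hv0, Pi.single_apply]
    rw [hsum]
    exact Submodule.sum_mem _ fun a _ => Submodule.smul_mem _ _ (hsingle a)

open scoped Classical in
/-- The circuit-hyperplanes as a finite family of finite sets. -/
noncomputable def circuitHyperplanes (M : Matroid (Fin (n + 1))) : Finset (Finset (Fin (n + 1))) :=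
  Finset.univ.filter fun H => M.IsCircuitHyperplane (H : Set (Fin (n + 1)))

theorem mem_circuitHyperplanes {H : Finset (Fin (n + 1))} :
    H ∈ M.circuitHyperplanes ↔ M.IsCircuitHyperplane (H : Set (Fin (n + 1))) := by
  simp [circuitHyperplanes]

theorem card_circuitHyperplanes :
    M.circuitHyperplanes.card =
      {H : Set (Fin (n + 1)) | M.IsCircuitHyperplane H}.ncard := by
  have : {H : Set (Fin (n + 1)) | M.IsCircuitHyperplane H} =
      (fun H : Finset (Fin (n + 1)) => (H : Set (Fin (n + 1)))) '' M.circuitHyperplanes := by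
    ext H
    simp only [Set.mem_ofPred_eq, Set.mem_image, Finset.mem_coe, mem_circuitHyperplanes]
    constructor
    · intro h
      exact ⟨(Set.toFinite H).toFinset, by simpa using h, by simp⟩
    · rintro ⟨H', h, rfl⟩
      exact h
  rw [this, Set.ncard_image_of_injective _ Finset.coe_injective, Set.ncard_coe_finset]

theorem card_of_mem_circuitHyperplanes (hrank : M.eRank = (d : ℕ∞) + 1)
    {H : Finset (Fin (n + 1))} (hH : H ∈ M.circuitHyperplanes) : H.card = d + 1 := by
  have := (mem_circuitHyperplanes.1 hH).encard_eq
  rw [hrank, Set.encard_coe_eq_coe_finsetCard] at this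
  exact_mod_cast this

theorem card_inter_of_mem_circuitHyperplanes (hrank : M.eRank = (d : ℕ∞) + 1)
    {H H' : Finset (Fin (n + 1))} (hH : H ∈ M.circuitHyperplanes)
    (hH' : H' ∈ M.circuitHyperplanes) (hne : H ≠ H') : (H ∩ H').card + 2 ≤ d + 1 := by
  have := (mem_circuitHyperplanes.1 hH).encard_inter_add_two_le (mem_circuitHyperplanes.1 hH')
    (by exact_mod_cast hne)
  rw [hrank, ← Finset.coe_inter, Set.encard_coe_eq_coe_finsetCard] at this
  exact_mod_cast this

/-- The base polytope of a sparse paving matroid is the part of the hypersimplex not cut off by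
the circuit-hyperplanes. -/
theorem toLp_mem_basePolytope_iff (hE : M.E = Set.univ) (hrank : M.eRank = (d : ℕ∞) + 1)
    (hsp : M.IsSparsePaving) {x : Fin (n + 1) → ℝ} :
    WithLp.toLp 2 x ∈ M.basePolytope ↔
      x ∈ hypersimplex (Fin (n + 1)) (d + 1) ∧ ∀ H ∈ M.circuitHyperplanes, ∑ i ∈ H, x i ≤ d := by
  have hbase : ∀ X : Finset (Fin (n + 1)), M.IsBase (X : Set (Fin (n + 1))) ↔
      X.card = d + 1 ∧ X ∉ M.circuitHyperplanes := by
    intro X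
    rw [isBase_iff_of_isSparsePaving hE hsp, mem_circuitHyperplanes, hrank,
      Set.encard_coe_eq_coe_finsetCard]
    norm_cast
  have himage : incidenceVector '' {B : Set (Fin (n + 1)) | M.IsBase B} =
      (WithLp.linearEquiv 2 ℝ (Fin (n + 1) → ℝ)).symm ''
        (indicatorVector '' {X | X.card = d + 1 ∧ X ∉ M.circuitHyperplanes}) := by
    have hvec : ∀ X : Finset (Fin (n + 1)), incidenceVector (X : Set (Fin (n + 1))) =
        (WithLp.linearEquiv 2 ℝ (Fin (n + 1) → ℝ)).symm (indicatorVector X) := by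
      intro X
      ext i
      simp [incidenceVector, indicatorVector, Set.indicator_apply]
    ext y
    constructor
    · rintro ⟨B, hB, rfl⟩
      lift B to Finset (Fin (n + 1)) using Set.toFinite B
      exact ⟨_, ⟨B, (hbase B).1 hB, rfl⟩, (hvec B).symm⟩
    · rintro ⟨_, ⟨X, hX, rfl⟩, rfl⟩
      exact ⟨X, (hbase X).2 hX, hvec X⟩
  have hmem : WithLp.toLp 2 x ∈ M.basePolytope ↔ x ∈ convexHull ℝ
      (indicatorVector '' {X | X.card = d + 1 ∧ X ∉ M.circuitHyperplanes}) := by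
    have h := LinearMap.image_convexHull
      (WithLp.linearEquiv 2 ℝ (Fin (n + 1) → ℝ)).symm.toLinearMap
      (indicatorVector '' {X | X.card = d + 1 ∧ X ∉ M.circuitHyperplanes})
    rw [LinearEquiv.coe_coe] at h
    rw [basePolytope, himage, ← h]
    exact (WithLp.linearEquiv 2 ℝ (Fin (n + 1) → ℝ)).symm.injective.mem_set_image
  rw [hmem]
  constructor
  · intro hx
    refine convexHull_min (t := {x | x ∈ hypersimplex (Fin (n + 1)) (d + 1) ∧
      ∀ H ∈ M.circuitHyperplanes, ∑ i ∈ H, x i ≤ d}) ?_ ?_ hx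
    · rintro _ ⟨X, ⟨hX, hXC⟩, rfl⟩
      refine ⟨indicatorVector_mem_hypersimplex hX, fun H hH => ?_⟩
      rw [sum_indicatorVector]
      have hHc := card_of_mem_circuitHyperplanes hrank hH
      -- `X` and `H` have equal size and differ, so neither contains the other.
      have hlt : (X ∩ H).card < X.card := by
        refine Finset.card_lt_card (Finset.inter_subset_left.ssubset_of_ne fun h => hXC ?_)
        rwa [Finset.eq_of_subset_of_card_le (Finset.inter_eq_left.1 h) (by omega)]
      have : (X ∩ H).card ≤ d := by omega
      exact_mod_cast this
    · intro x hx y hy a b ha hb hab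
      refine ⟨convex_hypersimplex _ hx.1 hy.1 ha hb hab, fun H hH => ?_⟩
      have h1 := mul_le_mul_of_nonneg_left (hx.2 H hH) ha
      have h2 := mul_le_mul_of_nonneg_left (hy.2 H hH) hb
      simp only [Pi.add_apply, Pi.smul_apply, smul_eq_mul, Finset.sum_add_distrib,
        ← Finset.mul_sum]
      calc _ ≤ a * d + b * d := add_le_add h1 h2
        _ = d := by rw [← add_mul, hab, one_mul]
  · rintro ⟨hx, hH⟩
    refine mem_convexHull_of_sum_le _ (fun H hH => card_of_mem_circuitHyperplanes hrank hH)
      (fun H hH H' hH' hne => card_inter_of_mem_circuitHyperplanes hrank hH hH' hne) hx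
      fun H hHC => ?_
    push_cast
    simpa using hH H hHC

end Matroid

/-! ### Volumes of the hypersimplex and of its caps -/

theorem sum_hyperplaneLift {n : ℕ} (r : ℝ) (y : Fin n → ℝ) : ∑ i, hyperplaneLift r y i = r := by
  simp [hyperplaneLift, Fin.sum_univ_succ]

theorem continuous_hyperplaneLift {n : ℕ} (r : ℝ) :
    Continuous (hyperplaneLift r : (Fin n → ℝ) → Fin (n + 1) → ℝ) := by
  refine continuous_pi fun i => Fin.cases ?_ (fun j => ?_) i
  · simp only [hyperplaneLift, Fin.cons_zero]; fun_prop
  · simp only [hyperplaneLift, Fin.cons_succ]; fun_prop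

/-- The hypersimplex has volume `A_{n,d} / n!`. -/
theorem volume_hyperplaneLift_mem_hypersimplex {n : ℕ} (hn : 1 ≤ n) (d : ℕ) :
    volume {y : Fin n → ℝ | hyperplaneLift (d + 1) y ∈ hypersimplex (Fin (n + 1)) (d + 1)} =
      ENNReal.ofReal (eulerianNumber n d / n.factorial) := by
  obtain ⟨m, rfl⟩ : ∃ m, n = m + 1 := ⟨n - 1, by omega⟩
  rw [← volume_unitCube_slice]
  apply measure_congr
  -- The projected hypersimplex and the half-open slice differ only on the null sets `y i = 1` and
  -- `∑ y = d + 1`.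
  have h1 : ∀ᵐ y : Fin (m + 1) → ℝ, ∀ i, y i ≠ 1 := by
    rw [ae_all_iff]
    intro i
    have := volume_setOf_dotProduct_eq (Pi.single i (1 : ℝ))
      (fun h => by simpa using congrFun h i) 1
    rw [ae_iff]
    simpa [Pi.single_apply] using this
  have h2 : ∀ᵐ y : Fin (m + 1) → ℝ, ∑ i, y i ≠ d + 1 := by
    have := volume_setOf_dotProduct_eq (fun _ : Fin (m + 1) => (1 : ℝ))
      (fun h => by simpa using congrFun h 0) (d + 1)
    rw [ae_iff]
    simpa using this
  filter_upwards [h1, h2] with y hy1 hy2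
  refine propext ⟨fun h => ?_, fun h => ?_⟩
  · obtain ⟨hc, -⟩ := h
    have h0 := hc 0
    simp only [hyperplaneLift, Fin.cons_zero, Set.mem_Icc] at h0
    refine ⟨mem_unitCube.2 fun i => ?_, by linarith, lt_of_le_of_ne (by linarith) hy2⟩
    have hi := hc i.succ
    simp only [hyperplaneLift, Fin.cons_succ, Set.mem_Icc] at hi
    exact ⟨hi.1, lt_of_le_of_ne hi.2 (hy1 i)⟩
  · obtain ⟨hc, hd1, hd2⟩ := h
    rw [mem_unitCube] at hc
    refine ⟨fun i => Fin.cases ?_ (fun j => ?_) i, by rw [sum_hyperplaneLift]; push_cast; rfl⟩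
    · simp only [hyperplaneLift, Fin.cons_zero, Set.mem_Icc]
      constructor <;> linarith
    · simp only [hyperplaneLift, Fin.cons_succ, Set.mem_Icc]
      exact ⟨(hc j).1, (hc j).2.le⟩

/-- Near the vertex `e_H` the hypersimplex is described by the inequalities of a pyramid. -/
theorem mem_hypersimplex_and_le_sum_iff {ι : Type*} [Fintype ι] [DecidableEq ι] {d : ℕ}
    {H : Finset ι} (hH : H.card = d + 1) {x : ι → ℝ} (hx : ∑ i, x i = d + 1) :
    (x ∈ hypersimplex ι (d + 1) ∧ (d : ℝ) ≤ ∑ i ∈ H, x i) ↔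
      (∀ i, 0 ≤ if i ∈ H then 1 - x i else x i) ∧ ∑ i ∈ Hᶜ, x i ≤ 1 := by
  have hsplit := Finset.sum_add_sum_compl H x
  rw [hx] at hsplit
  constructor
  · rintro ⟨⟨hc, -⟩, hd⟩
    refine ⟨fun i => ?_, by linarith⟩
    have := hc i
    split_ifs <;> linarith [this.1, this.2]
  · rintro ⟨hc, h1⟩
    have hin : ∀ i ∈ H, 0 ≤ 1 - x i := fun i hi => by simpa [hi] using hc i
    have hout : ∀ i ∈ Hᶜ, 0 ≤ x i := fun i hi => by
      simpa [Finset.mem_compl.1 hi] using hc i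
    -- Both sums are at most `1`, so nonnegativity of the terms yields the remaining cube bounds.
    have hsumH : ∑ i ∈ H, (1 - x i) = ∑ i ∈ Hᶜ, x i := by
      rw [Finset.sum_sub_distrib, Finset.sum_const, hH, nsmul_eq_mul]
      push_cast
      linarith
    refine ⟨⟨fun i => ?_, by rw [hx]; push_cast; rfl⟩, by linarith⟩
    by_cases hi : i ∈ H
    · have h2 := Finset.single_le_sum hin hi
      exact ⟨by linarith, by linarith [hin i hi]⟩
    · have hi' := Finset.mem_compl.2 hi
      have h2 := Finset.single_le_sum hout hi'
      exact ⟨hout i hi', by linarith⟩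

/-- This reflection moves the vertex `e_H`, the apex of a cap, to the origin. -/
theorem measurePreserving_reflect {ι : Type*} [Fintype ι] (A : ι → Prop) [DecidablePred A] :
    MeasurePreserving (fun (y : ι → ℝ) i => if A i then 1 - y i else y i) := by
  have : ∀ i, MeasurePreserving (fun t : ℝ => if A i then 1 - t else t) := by
    intro i
    by_cases h : A i
    · simpa [h] using Measure.measurePreserving_sub_left volume (1 : ℝ)
    · simpa only [h, if_false] using! MeasurePreserving.id (volume : Measure ℝ)
  exact volume_preserving_pi this

theorem measurableSet_pyramid {ι : Type*} [Fintype ι] (A : ι → Prop) [DecidablePred A] :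
    MeasurableSet {x : ι → ℝ | (∀ i, 0 ≤ x i) ∧
      ∑ i : {i // A i}, x i ≤ ∑ i : {i // ¬ A i}, x i ∧ ∑ i : {i // ¬ A i}, x i ≤ 1} := by
  have h1 : Measurable fun x : ι → ℝ => ∑ i : {i // A i}, x i := by fun_prop
  have h2 : Measurable fun x : ι → ℝ => ∑ i : {i // ¬ A i}, x i := by fun_prop
  exact (measurableSet_orthant ι).inter ((measurableSet_le h1 h2).inter
    (measurableSet_le h2 measurable_const))

theorem volume_hyperplaneLift_le_sum {n d : ℕ} (hd : d < n) {H : Finset (Fin (n + 1))}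
    (hH : H.card = d + 1) :
    volume {y : Fin n → ℝ | hyperplaneLift (d + 1) y ∈ hypersimplex (Fin (n + 1)) (d + 1) ∧
      (d : ℝ) ≤ ∑ i ∈ H, hyperplaneLift (d + 1) y i} =
      ENNReal.ofReal ((n - 1).choose d / n.factorial) := by
  have hset : {y : Fin n → ℝ | hyperplaneLift (d + 1) y ∈ hypersimplex (Fin (n + 1)) (d + 1) ∧
      (d : ℝ) ≤ ∑ i ∈ H, hyperplaneLift (d + 1) y i} = {y : Fin n → ℝ |
      ((0 ≤ if 0 ∈ H then 1 - (d + 1 - ∑ i, y i) else d + 1 - ∑ i, y i) ∧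
        ∀ i : Fin n, 0 ≤ if i.succ ∈ H then 1 - y i else y i) ∧
      d + 1 - ((if 0 ∈ H then d + 1 - ∑ i, y i else 0) +
        ∑ i, if i.succ ∈ H then y i else 0) ≤ 1} := by
    ext y
    have hc := Finset.sum_add_sum_compl H (hyperplaneLift (d + 1 : ℝ) y)
    rw [sum_hyperplaneLift] at hc
    have hc' : ∑ i ∈ Hᶜ, hyperplaneLift (d + 1 : ℝ) y i =
        d + 1 - ∑ i, if i ∈ H then hyperplaneLift (d + 1 : ℝ) y i else 0 := by
      rw [Finset.sum_ite_mem, Finset.univ_inter]; linarith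
    rw [Set.mem_ofPred_eq, mem_hypersimplex_and_le_sum_iff hH (sum_hyperplaneLift _ y), hc',
      Fin.sum_univ_succ, Fin.forall_fin_succ]
    rfl
  rw [hset]
  have hsuccH : (Finset.univ.filter fun i : Fin n => i.succ ∈ H).card +
      (if (0 : Fin (n + 1)) ∈ H then 1 else 0) = d + 1 := by
    have h1 : ∑ i : Fin (n + 1), (if i ∈ H then 1 else 0) = d + 1 := by simp [hH]
    rw [Fin.sum_univ_succ, ← Finset.card_filter, add_comm] at h1
    exact h1
  have hcompl : (Finset.univ.filter fun i : Fin n => i.succ ∈ H).card +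
      (Finset.univ.filter fun i : Fin n => ¬ i.succ ∈ H).card = n := by
    rw [Finset.card_filter_add_card_filter_not, Finset.card_univ, Fintype.card_fin]
  have hsumsplit : ∀ y : Fin n → ℝ, ∑ i, y i = (∑ i : {i : Fin n // i.succ ∈ H}, y i) +
      ∑ i : {i : Fin n // ¬ i.succ ∈ H}, y i := fun y =>
    (Fintype.sum_subtype_add_sum_subtype (fun i : Fin n => i.succ ∈ H) y).symm
  have hsumH : ∀ y : Fin n → ℝ, ∑ i, (if i.succ ∈ H then y i else 0) =
      ∑ i : {i : Fin n // i.succ ∈ H}, y i := fun y => by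
    rw [← Finset.sum_filter]
    exact (Finset.sum_subtype _ (by simp) _)
  have hsumR : ∀ y : Fin n → ℝ, ∑ i : {i : Fin n // i.succ ∈ H},
      (if i.1.succ ∈ H then 1 - y i else y i) =
      ((Finset.univ.filter fun i : Fin n => i.succ ∈ H).card : ℝ) -
        ∑ i : {i : Fin n // i.succ ∈ H}, y i := fun y => by
    rw [Finset.sum_congr rfl fun i _ => if_pos i.2, Finset.sum_sub_distrib, Finset.sum_const,
      Finset.card_univ, Fintype.card_subtype, nsmul_eq_mul, mul_one]
  have hsumN : ∀ y : Fin n → ℝ, ∑ i : {i : Fin n // ¬ i.succ ∈ H},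
      (if i.1.succ ∈ H then 1 - y i else y i) = ∑ i : {i : Fin n // ¬ i.succ ∈ H}, y i := fun y =>
    Finset.sum_congr rfl fun i _ => if_neg i.2
  have hmp := measurePreserving_reflect (fun i : Fin n => i.succ ∈ H)
  -- After reflection the coordinates in `H` and in `Hᶜ` have equal sums. Eliminating coordinate `0`
  -- turns its nonnegativity into the inequality between the two remaining sums; the side containing
  -- `0` is the smaller one, so it plays the role of `A` in `volume_pyramid`.
  by_cases h0 : (0 : Fin (n + 1)) ∈ H
  · rw [if_pos h0] at hsuccH
    have hvol := volume_pyramid (fun i : Fin n => i.succ ∈ H) (p := d) (q := n - 1 - d)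
      (by rw [Fintype.card_subtype]; omega) (by rw [Fintype.card_subtype]; omega)
    rw [← hmp.measure_preimage (measurableSet_pyramid _).nullMeasurableSet] at hvol
    have e1 : d + (n - 1 - d) = n - 1 := by omega
    have e2 : n - 1 + 1 = n := by omega
    rw [e1, e2] at hvol
    rw [← hvol]
    congr 1
    ext y
    have hcard : ((Finset.univ.filter fun i : Fin n => i.succ ∈ H).card : ℝ) = d := by
      exact_mod_cast Nat.add_right_cancel hsuccH
    simp only [Set.mem_preimage, Set.mem_ofPred_eq, if_pos h0, hsumH, hsumR, hsumN, hcard]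
    rw [hsumsplit]
    constructor
    · rintro ⟨⟨h1, h2⟩, h3⟩
      exact ⟨h2, by linarith, by linarith⟩
    · rintro ⟨h2, h1, h3⟩
      exact ⟨⟨by linarith, h2⟩, by linarith⟩
  · rw [if_neg h0, add_zero] at hsuccH
    have hvol := volume_pyramid (fun i : Fin n => ¬ i.succ ∈ H) (p := n - 1 - d) (q := d)
      (by rw [Fintype.card_subtype]; omega)
      (by simp only [not_not]; rw [Fintype.card_subtype]; omega)
    rw [← hmp.measure_preimage (measurableSet_pyramid _).nullMeasurableSet] at hvol
    have e1 : n - 1 - d + d = n - 1 := by omega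
    have e2 : n - 1 + 1 = n := by omega
    have e3 : (n - 1).choose (n - 1 - d) = (n - 1).choose d := Nat.choose_symm (by omega)
    rw [e1, e2, e3] at hvol
    rw [← hvol]
    congr 1
    ext y
    have hnn : ∀ f : Fin n → ℝ, ∑ i : {i : Fin n // ¬ ¬ i.succ ∈ H}, f i =
        ∑ i : {i : Fin n // i.succ ∈ H}, f i := fun f =>
      Fintype.sum_equiv (Equiv.subtypeEquivRight fun _ => not_not) _ _ fun _ => rfl
    have hcard : ((Finset.univ.filter fun i : Fin n => i.succ ∈ H).card : ℝ) = d + 1 := by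
      exact_mod_cast hsuccH
    have hR := hnn fun i => if i.succ ∈ H then 1 - y i else y i
    rw [hsumR, hcard] at hR
    simp only [Set.mem_preimage, Set.mem_ofPred_eq, if_neg h0, hsumH, hsumN, hR]
    rw [hsumsplit]
    constructor
    · rintro ⟨⟨h1, h2⟩, h3⟩
      exact ⟨h2, by linarith, by linarith⟩
    · rintro ⟨h2, h1, h3⟩
      exact ⟨⟨by linarith, h2⟩, by linarith⟩

/-- The linear form is nonzero because `H` is neither empty nor, as `d < n`, everything. Hence open
and closed caps have the same volume. -/
theorem volume_hyperplaneLift_sum_eq {n d : ℕ} (hd : d < n) {H : Finset (Fin (n + 1))}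
    (hH : H.card = d + 1) :
    volume {y : Fin n → ℝ | ∑ i ∈ H, hyperplaneLift (d + 1) y i = d} = 0 := by
  let a : Fin n → ℝ := fun i => (if i.succ ∈ H then 1 else 0) - if 0 ∈ H then 1 else 0
  have hsum : ∀ y : Fin n → ℝ, ∑ i ∈ H, hyperplaneLift (d + 1) y i =
      (if 0 ∈ H then (d + 1 : ℝ) else 0) + ∑ i, a i * y i := by
    intro y
    have : ∑ i ∈ H, hyperplaneLift (d + 1 : ℝ) y i =
        ∑ i, if i ∈ H then hyperplaneLift (d + 1 : ℝ) y i else 0 := by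
      rw [Finset.sum_ite_mem, Finset.univ_inter]
    rw [this, Fin.sum_univ_succ]
    simp only [hyperplaneLift, Fin.cons_zero, Fin.cons_succ, a, sub_mul, Finset.sum_sub_distrib]
    split_ifs with h0
    · simp; ring
    · simp
  have ha : a ≠ 0 := by
    intro ha
    have hall : ∀ i : Fin n, (i.succ ∈ H ↔ (0 : Fin (n + 1)) ∈ H) := by
      intro i
      have := congrFun ha i
      by_cases h1 : i.succ ∈ H <;> by_cases h2 : (0 : Fin (n + 1)) ∈ H <;>
        simp [a, h1, h2] at this ⊢
    by_cases h0 : (0 : Fin (n + 1)) ∈ H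
    · have : H = Finset.univ := by
        ext i
        refine Fin.cases (by simpa using h0) (fun j => by simpa [hall] using h0) i
      rw [this, Finset.card_univ, Fintype.card_fin] at hH
      omega
    · have : H = ∅ := by
        ext i
        refine Fin.cases (by simpa using h0) (fun j => by simpa [hall] using h0) i
      rw [this] at hH
      simp at hH
  simp_rw [hsum]
  convert volume_setOf_dotProduct_eq a ha (d - if 0 ∈ H then (d + 1 : ℝ) else 0) using 4 with y
  constructor <;> intro h <;> linarith

theorem volume_hyperplaneLift_lt_sum {n d : ℕ} (hd : d < n) {H : Finset (Fin (n + 1))}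
    (hH : H.card = d + 1) :
    volume {y : Fin n → ℝ | hyperplaneLift (d + 1) y ∈ hypersimplex (Fin (n + 1)) (d + 1) ∧
      (d : ℝ) < ∑ i ∈ H, hyperplaneLift (d + 1) y i} =
      ENNReal.ofReal ((n - 1).choose d / n.factorial) := by
  rw [← volume_hyperplaneLift_le_sum hd hH]
  apply measure_congr
  have hne : ∀ᵐ y : Fin n → ℝ, ∑ i ∈ H, hyperplaneLift (d + 1 : ℝ) y i ≠ d := by
    rw [ae_iff]
    simpa using volume_hyperplaneLift_sum_eq hd hH
  filter_upwards [hne] with y hy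
  refine propext (and_congr_right fun _ => ?_)
  exact ⟨le_of_lt, fun h => lt_of_le_of_ne h hy.symm⟩

/-- The caps that two sets with small intersection cut off the hypersimplex are disjoint. -/
theorem not_lt_sum_of_lt_sum {ι : Type*} [Fintype ι] [DecidableEq ι] {d : ℕ} {H H' : Finset ι}
    (hinter : (H ∩ H').card + 2 ≤ d + 1) {x : ι → ℝ} (hx : x ∈ hypersimplex ι (d + 1))
    (hH : (d : ℝ) < ∑ i ∈ H, x i) : ¬ (d : ℝ) < ∑ i ∈ H', x i := by
  intro hH'
  -- The two sums over `H` and `H'` would exceed `2d` together, while union and intersection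
  -- contribute at most `(d + 1) + (d - 1)`.
  have h1 := Finset.sum_union_inter (s₁ := H) (s₂ := H') (f := x)
  have h2 : ∑ i ∈ H ∪ H', x i ≤ d + 1 := by
    have := Finset.sum_le_sum_of_subset_of_nonneg (Finset.subset_univ (H ∪ H'))
      fun i _ _ => (hx.1 i).1
    rw [hx.2] at this
    push_cast at this
    exact this
  have h3 : ∑ i ∈ H ∩ H', x i ≤ (H ∩ H').card := by
    have := Finset.sum_le_card_nsmul (H ∩ H') x 1 fun i _ => (hx.1 i).2
    simpa using this
  have h4 : ((H ∩ H').card : ℝ) + 1 ≤ d := by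
    have : (H ∩ H').card + 1 ≤ d := by omega
    exact_mod_cast this
  linarith

/-- The hypersimplex is the disjoint union of the truncated part and the caps; strict inequalities
in the caps make this exact, not merely up to null sets. -/
theorem volume_hypersimplex_sdiff_caps {n d : ℕ} (hd : d < n)
    (𝒞 : Finset (Finset (Fin (n + 1)))) (hcard : ∀ H ∈ 𝒞, H.card = d + 1)
    (hinter : ∀ H ∈ 𝒞, ∀ H' ∈ 𝒞, H ≠ H' → (H ∩ H').card + 2 ≤ d + 1) :
    (volume {y : Fin n → ℝ | hyperplaneLift (d + 1) y ∈ hypersimplex (Fin (n + 1)) (d + 1) ∧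
      ∀ H ∈ 𝒞, ∑ i ∈ H, hyperplaneLift (d + 1) y i ≤ d}).toReal =
      1 / n.factorial * (eulerianNumber n d - 𝒞.card * (n - 1).choose d) := by
  set Δ := {y : Fin n → ℝ | hyperplaneLift (d + 1) y ∈ hypersimplex (Fin (n + 1)) (d + 1)}
  set T : Finset (Fin (n + 1)) → Set (Fin n → ℝ) := fun H =>
    {y | hyperplaneLift (d + 1) y ∈ hypersimplex (Fin (n + 1)) (d + 1) ∧
      (d : ℝ) < ∑ i ∈ H, hyperplaneLift (d + 1) y i}
  set Q := {y : Fin n → ℝ | hyperplaneLift (d + 1) y ∈ hypersimplex (Fin (n + 1)) (d + 1) ∧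
      ∀ H ∈ 𝒞, ∑ i ∈ H, hyperplaneLift (d + 1) y i ≤ d}
  have hΔm : MeasurableSet Δ :=
    ((isCompact_hypersimplex _).isClosed.preimage (continuous_hyperplaneLift _)).measurableSet
  have hTm : ∀ H, MeasurableSet (T H) := fun H => by
    have hc := continuous_hyperplaneLift (n := n) (d + 1)
    exact hΔm.inter (measurableSet_lt measurable_const
      (Finset.measurable_sum _ fun i _ => ((continuous_apply i).comp hc).measurable))
  have hunion : Δ = Q ∪ ⋃ H ∈ 𝒞, T H := by
    ext y
    constructor
    · intro hy
      by_cases h : ∀ H ∈ 𝒞, ∑ i ∈ H, hyperplaneLift (d + 1 : ℝ) y i ≤ d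
      · exact Or.inl ⟨hy, h⟩
      · push Not at h
        obtain ⟨H, hH, hlt⟩ := h
        exact Or.inr (Set.mem_biUnion hH ⟨hy, hlt⟩)
    · rintro (h | h)
      · exact h.1
      · obtain ⟨H, -, hH⟩ := Set.mem_iUnion₂.1 h
        exact hH.1
  have hdisj : Disjoint Q (⋃ H ∈ 𝒞, T H) := by
    rw [Set.disjoint_left]
    intro y hy h
    obtain ⟨H, hHC, hH⟩ := Set.mem_iUnion₂.1 h
    exact absurd hH.2 (not_lt.2 (hy.2 H hHC))
  have hpair : Set.PairwiseDisjoint (𝒞 : Set (Finset (Fin (n + 1)))) T := by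
    intro H hH H' hH' hne
    refine Set.disjoint_left.2 fun y hy hy' => ?_
    exact not_lt_sum_of_lt_sum (hinter H hH H' hH' hne) hy.1 hy.2 hy'.2
  have hvol : volume Δ = volume Q + ∑ H ∈ 𝒞, volume (T H) := by
    rw [hunion, measure_union hdisj (Finset.measurableSet_biUnion _ fun H _ => hTm H),
      measure_biUnion_finset hpair fun H _ => hTm H]
  have hT : ∑ H ∈ 𝒞, volume (T H) =
      ENNReal.ofReal (𝒞.card * ((n - 1).choose d / n.factorial)) := by
    rw [Finset.sum_congr rfl fun H hH => volume_hyperplaneLift_lt_sum hd (hcard H hH),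
      Finset.sum_const, nsmul_eq_mul, ENNReal.ofReal_mul (by positivity), ENNReal.ofReal_natCast]
  rw [volume_hyperplaneLift_mem_hypersimplex (by omega), hT] at hvol
  have hfin : volume Q ≠ ⊤ := by
    intro h
    rw [h, top_add] at hvol
    exact ENNReal.ofReal_ne_top hvol
  have := congrArg ENNReal.toReal hvol
  rw [ENNReal.toReal_add hfin ENNReal.ofReal_ne_top, ENNReal.toReal_ofReal (by positivity),
    ENNReal.toReal_ofReal (by positivity)] at this
  rw [eq_sub_of_add_eq this.symm]
  ring

theorem theorem2 (n d α : ℕ) (hn : 1 ≤ n) (M : Matroid (Fin (n + 1))) (hE : M.E = Set.univ)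
    (hrank : M.eRank = (d : ℕ∞) + 1) (hconn : M.IsConnected) (hsp : M.IsSparsePaving)
    (hα : {H : Set (Fin (n + 1)) | M.IsCircuitHyperplane H}.ncard = α) :
    normalisedVolume M.basePolytope =
      (1 / (n.factorial : ℝ)) *
        ((eulerianNumber n d : ℝ) - (α : ℝ) * ((n - 1).choose d : ℝ)) := by
  rw [normalisedVolume_eq (d + 1) _ (fun x hx => Matroid.sum_of_mem_basePolytope hrank hx)
    (Matroid.vectorSpan_basePolytope hE hrank hconn)]
  simp_rw [Matroid.toLp_mem_basePolytope_iff hE hrank hsp]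
  rw [volume_hypersimplex_sdiff_caps (Matroid.lt_of_isConnected_of_eRank_eq hn hE hrank hconn)
    M.circuitHyperplanes (fun H hH => Matroid.card_of_mem_circuitHyperplanes hrank hH)
    fun H hH H' hH' hne => Matroid.card_inter_of_mem_circuitHyperplanes hrank hH hH' hne,
    Matroid.card_circuitHyperplanes, hα]
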